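/- Let $A_a,B_a$ ($a=1,\dots,n$) be the annihilation operators of $2n$ decoupled harmonic oscillators, $[A_a,A_b^\dagger]=[B_a,B_b^\dagger]=\delta_{ab}$ (all other commutators zero), acting on the Hilbert space with orthonormal occupation-number basis and vacuum $|0\rangle$. Put $$E_{ab}=A_a^\dagger A_b+B_a^\dagger B_b+\delta_{ab},\qquad \mathcal A_{ab}=\tfrac12(E_{ab}-\delta_{ab}),\qquad \mathcal A_a=\mathcal A_{aa},\qquad \mathcal A=\sum_a\mathcal A_a,$$ $$\widetilde F_{ab}=B_a^\dagger A_b^\dagger-A_a^\dagger B_b^\dagger,\qquad \widetilde F_\zeta=\sum_{a,b}\zeta_{ab}\widetilde F_{ab}.$$ For $\zeta\in\Omega_n=\{\zeta\in M_n(\mathbb C):\zeta^T=-\zeta,\ \zeta^*\zeta<1\}$ let $$|\zeta\rangle=\det(1-\zeta^*\zeta)^{1/2}\exp(\tfrac12\widetilde F_\zeta)|0\rangle=\det(1-\zeta^*\zeta)^{1/2}\sum_{k\ge0}\tfrac1{k!}(\tfrac12\widetilde F_\zeta)^k|0\rangle .$$ Write $\langle X\rangle=\langle\zeta|X|\zeta\rangle$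 and $\mathrm{Var}(X)=\langle X^2\rangle-\langle X\rangle^2$. (1) For every $\zeta\in\Omega_n$ the series converges, $|\zeta\rangle$ is a unit vector, it lies in the (maximal) domains of the operators $\mathcal A_{ab}$, $\mathcal A_a\mathcal A_b$, $\mathcal A$, $\mathcal A^2$, and $$\langle\mathcal A_a\rangle=\big[\zeta^*\zeta(1-\zeta^*\zeta)^{-1}\big]_{aa},\qquad \langle\mathcal A\rangle=\mathrm{tr}\big[\zeta^*\zeta(1-\zeta^*\zeta)^{-1}\big],$$ $$\mathrm{Var}(\mathcal A_a)=\tfrac12\langle\mathcal A_a\rangle\big(\langle\mathcal A_a\rangle+1\big),\qquad \mathrm{Var}(\mathcal A)=\sum_{a,b}\langle\mathcal A_{ab}\rangle\big(\langle\mathcal A_{ba}\rangle+\delta_{ab}\big).$$ (2) There is $c\in(0,1]$, depending only on $n$, such that the following holds for every family (in particular every sequence) of non-zero $\zeta\in\Omega_n$ along which all the non-zero eigenvalues of $\zeta^*\zeta$ tend to $1$. The variance $\mathrm{Var}(\mathcal A)$ tends to $+\infty$, while the coefficient of variation $\sqrt{\mathrm{Var}(\mathcal A)}/\langle\mathcal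 A\rangle$ approaches the interval $[c,1]$ (it is eventually in every neighbourhood of it); hence it has limit points, and every limit point lies in $(0,1]$. If moreover the relative rates of approach converge, that is, if with $\lambda_1\ge\dots\ge\lambda_n$ the eigenvalues of $\zeta^*\zeta$ the ratio $(1-\lambda_1)/(1-\lambda_j)$ converges for every $j$, then the coefficient of variation converges to a value in $(0,1]$. -/

import Mathlib

open Filter Topology
open scoped Matrix ComplexOrder

noncomputable section

namespace CoherentIntertwiner

/-- The `2n` oscillator modes: `Sum.inl a` is the mode of `A_a`, `Sum.inr a` that of `B_a`. -/
abbrev Mode (n : ℕ) : Type := Fin n ⊕ Fin n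

/-- Occupation numbers of the `2n` oscillators; they label the orthonormal basis `|μ,ν⟩`. -/
abbrev Occ (n : ℕ) : Type := Mode n → ℕ

/-- Formal (not necessarily normalisable) vectors `∑ ψ(x) |x⟩`, given by their coefficients. -/
abbrev Formal (n : ℕ) : Type := Occ n → ℂ

/-- The Hilbert space of the `2n` oscillators: square-summable coefficients. -/
abbrev Fock (n : ℕ) : Type := lp (fun _ : Occ n => ℂ) 2

variable {n : ℕ}

/-- Lowering operator of the mode `m`: `|x⟩ ↦ √(x m) |x - e_m⟩`. In coefficients,
the coefficient of `|x⟩` in the image of `ψ` is `√(x m + 1) ψ (x + e_m)`. -/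
def lower (m : Mode n) : Module.End ℂ (Formal n) where
  toFun ψ x := (Real.sqrt ((x m : ℝ) + 1) : ℂ) * ψ (Function.update x m (x m + 1))
  map_add' ψ φ := by funext x; simp [mul_add]
  map_smul' c ψ := by funext x; simp [mul_left_comm]

/-- Raising operator of the mode `m`: `|x⟩ ↦ √(x m + 1) |x + e_m⟩`. In coefficients,
the coefficient of `|x⟩` in the image of `ψ` is `√(x m) ψ (x - e_m)`, which is `0` when
`x m = 0`. -/
def raise (m : Mode n) : Module.End ℂ (Formal n) where
  toFun ψ x := (Real.sqrt (x m : ℝ) : ℂ) * ψ (Function.update x m (x m - 1))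
  map_add' ψ φ := by funext x; simp [mul_add]
  map_smul' c ψ := by funext x; simp [mul_left_comm]

/-- `A_a`, `A_a†`, `B_a`, `B_a†`. -/
def opA (a : Fin n) : Module.End ℂ (Formal n) := lower (Sum.inl a)
def opAdag (a : Fin n) : Module.End ℂ (Formal n) := raise (Sum.inl a)
def opB (a : Fin n) : Module.End ℂ (Formal n) := lower (Sum.inr a)
def opBdag (a : Fin n) : Module.End ℂ (Formal n) := raise (Sum.inr a)

/-- `E_ab = A_a† A_b + B_a† B_b + δ_ab`. -/
def opE (a b : Fin n) : Module.End ℂ (Formal n) :=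
  opAdag a * opA b + opBdag a * opB b + (if a = b then 1 else 0)

/-- `F̃_ab = B_a† A_b† - A_a† B_b†`. -/
def opFt (a b : Fin n) : Module.End ℂ (Formal n) :=
  opBdag a * opAdag b - opAdag a * opBdag b

/-- `F̃_z = ∑_ab z_ab F̃_ab`. -/
def opFtOf (z : Matrix (Fin n) (Fin n) ℂ) : Module.End ℂ (Formal n) :=
  ∑ a, ∑ b, z a b • opFt a b

/-- `𝒜_ab = ½ (E_ab - δ_ab)`. -/
def areaAB (a b : Fin n) : Module.End ℂ (Formal n) :=
  (1 / 2 : ℂ) • (opE a b - (if a = b then 1 else 0))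

/-- The area operator `𝒜_a = 𝒜_aa` of the leg `a`. -/
def area (a : Fin n) : Module.End ℂ (Formal n) := areaAB a a

/-- The total area operator `𝒜 = ∑_a 𝒜_a`. -/
def totalArea : Module.End ℂ (Formal n) := ∑ a, area a

/-- The operator in the Hilbert space given by a formal expression `T` in the oscillators, on its
maximal domain: all `ψ` in the Hilbert space for which `T ψ` lies in the Hilbert space. -/
def hilbertOp (T : Module.End ℂ (Formal n)) : Fock n →ₗ.[ℂ] Fock n where
  domain :=
    { carrier := {ψ | Memℓp (T (ψ : Formal n)) 2}
      zero_mem' := by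
        simp only [Set.mem_ofPred_eq, lp.coeFn_zero, map_zero]
        exact zero_memℓp
      add_mem' := by
        intro ψ φ hψ hφ
        simp only [Set.mem_ofPred_eq, lp.coeFn_add, map_add] at *
        exact hψ.add hφ
      smul_mem' := by
        intro c ψ hψ
        simp only [Set.mem_ofPred_eq, lp.coeFn_smul, map_smul] at *
        exact hψ.const_smul c }
  toFun :=
    { toFun := fun ψ => ⟨T ((ψ : Fock n) : Formal n), ψ.2⟩
      map_add' := by
        intro ψ φ
        apply lp.ext
        exact map_add T _ _
      map_smul' := by
        intro c ψ
        apply lp.ext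
        simp }

open Classical in
/-- `⟨ψ|T|ψ⟩`, for `ψ` in the domain of `T`. -/
def expect (T : Module.End ℂ (Formal n)) (ψ : Fock n) : ℂ :=
  if h : ψ ∈ (hilbertOp T).domain then inner ℂ ψ (hilbertOp T ⟨ψ, h⟩) else 0

/-- `Cov(S, T) = ⟨ST⟩ - ⟨S⟩⟨T⟩`. -/
def cov (S T : Module.End ℂ (Formal n)) (ψ : Fock n) : ℂ :=
  expect (S * T) ψ - expect S ψ * expect T ψ

/-- `Var(T) = Cov(T, T)`. -/
def var (T : Module.End ℂ (Formal n)) (ψ : Fock n) : ℂ := cov T T ψ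

/-- The coefficient of variation `√Var(T) / ⟨T⟩`. -/
def coeffVar (T : Module.End ℂ (Formal n)) (ψ : Fock n) : ℝ :=
  Real.sqrt (var T ψ).re / (expect T ψ).re

/-- The bounded symmetric domain `Ω_n`: antisymmetric `ζ` with `ζ* ζ < 1`. -/
def Omega (n : ℕ) : Set (Matrix (Fin n) (Fin n) ℂ) :=
  {ζ | ζᵀ = -ζ ∧ (1 - ζᴴ * ζ).PosDef}

/-- The vacuum `|0⟩`. -/
def vac : Formal n := Pi.single 0 1

/-! Vectors with finitely many non-zero coefficients (`Memℓp _ 0`) are preserved by raising. -/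

theorem raise_finite (m : Mode n) {ψ : Formal n} (h : Memℓp ψ 0) : Memℓp (raise m ψ) 0 := by
  rw [memℓp_zero_iff] at *
  refine (h.image fun x => Function.update x m (x m + 1)).subset ?_
  intro x hx
  have hx' : (Real.sqrt (x m : ℝ) : ℂ) * ψ (Function.update x m (x m - 1)) ≠ 0 := hx
  have h1 : x m ≠ 0 := by
    intro h0
    apply hx'
    simp [h0]
  refine ⟨Function.update x m (x m - 1), right_ne_zero_of_mul hx', ?_⟩
  have h2 : x m - 1 + 1 = x m := by omega
  simp [h2]

theorem opFtOf_finite (z : Matrix (Fin n) (Fin n) ℂ) {ψ : Formal n} (h : Memℓp ψ 0) :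
    Memℓp (opFtOf z ψ) 0 := by
  have h1 : ∀ a b, Memℓp ((z a b • opFt a b) ψ) 0 := by
    intro a b
    have := ((raise_finite (Sum.inr a) (raise_finite (Sum.inl b) h)).sub
      (raise_finite (Sum.inl a) (raise_finite (Sum.inr b) h))).const_smul (z a b)
    exact this
  have h2 : opFtOf z ψ = ∑ a, ∑ b, (z a b • opFt a b) ψ := by
    simp [opFtOf, LinearMap.sum_apply]
  have h3 : ∀ a, Memℓp (∑ b, (z a b • opFt a b) ψ) 0 := by
    intro a
    have := Memℓp.finsetSum (p := 0) Finset.univ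
      (f := fun b => (z a b • opFt a b) ψ) (fun b _ => h1 a b)
    convert this using 1
    funext x
    simp
  rw [h2]
  have := Memℓp.finsetSum (p := 0) Finset.univ
      (f := fun a => ∑ b, (z a b • opFt a b) ψ) (fun a _ => h3 a)
  convert this using 1
  funext x
  simp

theorem powVec_memℓp (ζ : Matrix (Fin n) (Fin n) ℂ) (k : ℕ) :
    Memℓp ((((1 / 2 : ℂ) • opFtOf ζ) ^ k) vac) 2 := by
  have h : Memℓp ((((1 / 2 : ℂ) • opFtOf ζ) ^ k) vac) 0 := by
    induction k with
    | zero =>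
      rw [memℓp_zero_iff]
      refine (Set.finite_singleton (0 : Occ n)).subset ?_
      intro x hx
      by_contra hne
      apply hx
      have hne' : x ≠ 0 := hne
      simp [vac, Pi.single_apply, hne']
    | succ k ih =>
      rw [pow_succ']
      exact (opFtOf_finite ζ ih).const_smul (1 / 2 : ℂ)
  exact h.of_exponent_ge (by simp)

/-- `(½ F̃_ζ)^k |0⟩` as a vector of the Hilbert space. -/
def powVec (ζ : Matrix (Fin n) (Fin n) ℂ) (k : ℕ) : Fock n :=
  ⟨(((1 / 2 : ℂ) • opFtOf ζ) ^ k) vac, powVec_memℓp ζ k⟩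

/-- The terms `(½ F̃_ζ)^k |0⟩ / k!` of the series of `exp(½ F̃_ζ) |0⟩`. -/
def expTerm (ζ : Matrix (Fin n) (Fin n) ℂ) (k : ℕ) : Fock n :=
  ((k.factorial : ℂ)⁻¹) • powVec ζ k

/-- The coherent state `|ζ⟩ = det(1 - ζ* ζ)^{1/2} exp(½ F̃_ζ) |0⟩`. For `ζ ∈ Ω_n` the determinant
is a positive real number. -/
def coherent (ζ : Matrix (Fin n) (Fin n) ℂ) : Fock n :=
  (Real.sqrt (1 - ζᴴ * ζ).det.re : ℂ) • ∑' k, expTerm ζ k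

/-- The eigenvalues of `ζ* ζ`, repeated according to multiplicity. -/
def eig (ζ : Matrix (Fin n) (Fin n) ℂ) : Fin n → ℝ :=
  (Matrix.isHermitian_conjTranspose_mul_self ζ).eigenvalues

/-- Along the filter `l`, all the non-zero eigenvalues of `(Z i)* (Z i)` tend to `1`. -/
def NonzeroEigTendToOne {ι : Type*} (l : Filter ι) (Z : ι → Matrix (Fin n) (Fin n) ℂ) : Prop :=
  ∀ ε : ℝ, 0 < ε → ∀ᶠ i in l, ∀ j, eig (Z i) j ≠ 0 → |eig (Z i) j - 1| < ε

end CoherentIntertwiner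

end

/-!
The coherent state is a pair-coherent state: annihilating a mode amounts to creating its partners,
`a_m ψ = ∑ W m d a_d† ψ`, where the symmetric matrix `W` with blocks `-ζ` and `ζ` pairs the modes
`A` with the modes `B`. Hence any annihilation operator can be traded for creation operators, whose
adjoints can be traded in turn, and commuting back gives the Wick recursion `N = W* W (1 + N)` for
the occupations `N = ⟨a† a⟩`. Its solution `N = W* W (1 - W* W)⁻¹`, applied twice, yields the means
and the variances. Applied to the homogeneous terms of the exponential series, the same recursion
shows that the generating function `G` of their squared norms satisfies `2 G' = G ∑ λ / (1 - λ X)`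
over the eigenvalues `λ` of `W* W`. Hence `G² = ∏ (1 - λ X)⁻¹`, which gives convergence and the
norm.

In terms of the eigenvalues `λ` of `ζ* ζ`, the total area has mean `∑ λ / (1 - λ)` and variance
`∑ λ / (1 - λ)²`, as a sum of independent geometric variables. The square of the mean is at most `n`
times the variance by the Cauchy–Schwarz inequality and, all terms being non-negative, it is at
least the variance times the least non-zero `λ`.
-/

noncomputable section

namespace CoherentIntertwiner

open scoped InnerProductSpace

section GeometricProducts

variable {ι R : Type*}

/-- The power series `∏ (1 - μ i X)⁻¹`, written as a product of geometric series: the generating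
function of the complete homogeneous symmetric polynomials in `μ`. -/
def geomProd [CommRing R] (s : Finset ι) (μ : ι → R) : PowerSeries R :=
  ∏ i ∈ s, PowerSeries.mk fun k => μ i ^ k

theorem derivative_mk_pow [CommRing R] (x : R) :
    PowerSeries.derivative R (PowerSeries.mk fun k => x ^ k) =
      (PowerSeries.mk fun k => x ^ k) * PowerSeries.mk fun k => x ^ (k + 1) := by
  ext k
  have hterm : ∀ p ∈ Finset.HasAntidiagonal.antidiagonal k,
      x ^ p.1 * x ^ (p.2 + 1) = x ^ (k + 1) := by
    intro p hp
    rw [← pow_add, ← add_assoc, Finset.HasAntidiagonal.mem_antidiagonal.1 hp]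
  simp only [PowerSeries.coeff_derivative, PowerSeries.coeff_mul, PowerSeries.coeff_mk,
    Finset.sum_congr rfl hterm, Finset.sum_const, Finset.Nat.card_antidiagonal, nsmul_eq_mul]
  push_cast
  ring

theorem derivative_geomProd [CommRing R] (s : Finset ι) (μ : ι → R) :
    PowerSeries.derivative R (geomProd s μ) =
      geomProd s μ * ∑ i ∈ s, PowerSeries.mk fun k => μ i ^ (k + 1) := by
  classical
  induction s using Finset.induction_on with
  | empty => simp [geomProd]
  | insert i s hi ih =>
    rw [geomProd] at ih ⊢
    rw [Finset.prod_insert hi, Finset.sum_insert hi, Derivation.leibniz, ih, derivative_mk_pow]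
    simp only [smul_eq_mul]
    ring

theorem constantCoeff_geomProd [CommRing R] (s : Finset ι) (μ : ι → R) :
    PowerSeries.constantCoeff (geomProd s μ) = 1 := by
  simp [geomProd, map_prod, ← PowerSeries.coeff_zero_eq_constantCoeff_apply]

theorem rescale_geomProd [CommRing R] (s : Finset ι) (μ : ι → R) (t : R) :
    PowerSeries.rescale t (geomProd s μ) = geomProd s fun i => t * μ i := by
  simp only [geomProd, map_prod, PowerSeries.rescale_mk, mul_pow]

theorem eq_of_derivative_eq_mul {K : Type*} [Field K] [CharZero K] {f g p : PowerSeries K}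
    (hf : PowerSeries.derivative K f = f * p) (hg : PowerSeries.derivative K g = g * p)
    (h0 : PowerSeries.constantCoeff f = PowerSeries.constantCoeff g) : f = g := by
  ext k
  induction k using Nat.strong_induction_on with
  | _ k ih =>
    cases k with
    | zero => simpa using h0
    | succ k =>
      have hcoeff : PowerSeries.coeff k (f * p) = PowerSeries.coeff k (g * p) := by
        rw [PowerSeries.coeff_mul, PowerSeries.coeff_mul]
        refine Finset.sum_congr rfl fun q hq => ?_
        have hsum := Finset.HasAntidiagonal.mem_antidiagonal.1 hq
        rw [ih q.1 (by lia)]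
      rw [← hf, ← hg, PowerSeries.coeff_derivative, PowerSeries.coeff_derivative] at hcoeff
      exact mul_right_cancel₀ (Nat.cast_add_one_ne_zero k) hcoeff

theorem coeff_geomProd_nonneg (s : Finset ι) {μ : ι → ℝ} (hμ : ∀ i, 0 ≤ μ i) (k : ℕ) :
    0 ≤ PowerSeries.coeff k (geomProd s μ) := by
  classical
  induction s using Finset.induction_on generalizing k with
  | empty =>
    rw [geomProd, Finset.prod_empty, PowerSeries.coeff_one]
    positivity
  | insert i s hi ih =>
    rw [geomProd, Finset.prod_insert hi, PowerSeries.coeff_mul]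
    refine Finset.sum_nonneg fun p _ => mul_nonneg ?_ (ih p.2)
    simpa using pow_nonneg (hμ i) p.1

theorem hasSum_coeff_mul {f g : PowerSeries ℝ} {a b : ℝ} (hf0 : ∀ k, 0 ≤ PowerSeries.coeff k f)
    (hg0 : ∀ k, 0 ≤ PowerSeries.coeff k g) (hf : HasSum (fun k => PowerSeries.coeff k f) a)
    (hg : HasSum (fun k => PowerSeries.coeff k g) b) :
    HasSum (fun k => PowerSeries.coeff k (f * g)) (a * b) := by
  have hf' : Summable fun k => ‖PowerSeries.coeff k f‖ := by
    simpa only [Real.norm_of_nonneg (hf0 _)] using hf.summable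
  have hg' : Summable fun k => ‖PowerSeries.coeff k g‖ := by
    simpa only [Real.norm_of_nonneg (hg0 _)] using hg.summable
  simp only [PowerSeries.coeff_mul]
  rw [← hf.tsum_eq, ← hg.tsum_eq, tsum_mul_tsum_eq_tsum_sum_antidiagonal_of_summable_norm hf' hg']
  exact (summable_norm_sum_mul_antidiagonal_of_summable_norm hf' hg').of_norm.hasSum

theorem hasSum_coeff_geomProd (s : Finset ι) {μ : ι → ℝ} (hμ : ∀ i, μ i ∈ Set.Ico 0 1) :
    HasSum (fun k => PowerSeries.coeff k (geomProd s μ)) (∏ i ∈ s, (1 - μ i)⁻¹) := by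
  classical
  induction s using Finset.induction_on with
  | empty => simpa [geomProd, PowerSeries.coeff_one] using hasSum_ite_eq (0 : ℕ) (1 : ℝ)
  | insert i s hi ih =>
    rw [geomProd, Finset.prod_insert hi, Finset.prod_insert hi]
    refine hasSum_coeff_mul (fun k => ?_) (coeff_geomProd_nonneg s fun j => (hμ j).1) ?_ ih
    · simpa using pow_nonneg (hμ i).1 k
    · simpa using hasSum_geometric_of_lt_one (hμ i).1 (hμ i).2

theorem exists_coeff_geomProd_le [Finite ι] (s : Finset ι) {μ : ι → ℝ}
    (hμ : ∀ i, μ i ∈ Set.Ico 0 1) :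
    ∃ C, ∃ r ∈ Set.Ico (0 : ℝ) 1, ∀ k, PowerSeries.coeff k (geomProd s μ) ≤ C * r ^ k := by
  have hnear : ∀ᶠ t : ℝ in 𝓝[>] 1, ∀ i, t * μ i < 1 := by
    refine eventually_all.2 fun i => nhdsWithin_le_nhds ?_
    exact (continuous_mul_const (μ i)).continuousAt.eventually_lt continuousAt_const
      (by simpa using (hμ i).2)
  obtain ⟨t, ht, ht1 : 1 < t⟩ := (hnear.and self_mem_nhdsWithin).exists
  have ht0 : 0 < t := one_pos.trans ht1
  have hscaled : ∀ i, t * μ i ∈ Set.Ico 0 1 := fun i => ⟨mul_nonneg ht0.le (hμ i).1, ht i⟩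
  refine ⟨∏ i ∈ s, (1 - t * μ i)⁻¹, t⁻¹, ⟨by positivity, inv_lt_one_of_one_lt₀ ht1⟩, fun k => ?_⟩
  have hle := le_hasSum (hasSum_coeff_geomProd s hscaled) k fun j _ =>
    coeff_geomProd_nonneg s (fun i => (hscaled i).1) j
  rw [← rescale_geomProd, PowerSeries.coeff_rescale] at hle
  rwa [inv_pow, ← div_eq_mul_inv, le_div_iff₀ (by positivity), mul_comm]

theorem summable_add_one_pow_mul_geometric (p : ℕ) {r : ℝ} (hr : r ∈ Set.Ico 0 1) :
    Summable fun k : ℕ => ((k : ℝ) + 1) ^ p * r ^ k := by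
  have hexpand : ∀ k : ℕ, ((k : ℝ) + 1) ^ p * r ^ k =
      ∑ i ∈ Finset.range (p + 1), p.choose i * ((k : ℝ) ^ i * r ^ k) := fun k => by
    rw [add_pow, Finset.sum_mul]
    exact Finset.sum_congr rfl fun i _ => by ring
  have hr' : ‖r‖ < 1 := by rw [Real.norm_of_nonneg hr.1]; exact hr.2
  simp only [hexpand]
  exact summable_sum fun i _ => (summable_pow_mul_geometric_of_norm_lt_one i hr').mul_left _

end GeometricProducts

section HermitianMatrices

variable {κ 𝕜 : Type*} [Fintype κ] [DecidableEq κ] [RCLike 𝕜]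

theorem trace_conjStarAlgAut (U : Matrix.unitaryGroup κ 𝕜) (D : Matrix κ κ 𝕜) :
    (Unitary.conjStarAlgAut 𝕜 _ U D).trace = D.trace := by
  rw [Unitary.conjStarAlgAut_apply, Matrix.trace_mul_comm, ← mul_assoc]
  simp

theorem det_conjStarAlgAut (U : Matrix.unitaryGroup κ 𝕜) (D : Matrix κ κ 𝕜) :
    (Unitary.conjStarAlgAut 𝕜 _ U D).det = D.det := by
  rw [Unitary.conjStarAlgAut_apply, Matrix.det_mul_comm, ← mul_assoc]
  simp

variable {A : Matrix κ κ 𝕜} (hA : A.IsHermitian)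

include hA

theorem trace_pow_eq_sum_eigenvalues (k : ℕ) :
    (A ^ k).trace = ∑ i, (hA.eigenvalues i : 𝕜) ^ k := by
  nth_rw 1 [hA.spectral_theorem]
  rw [← map_pow, trace_conjStarAlgAut, Matrix.diagonal_pow, Matrix.trace_diagonal]
  rfl

theorem one_sub_eq_conjStarAlgAut : 1 - A =
    Unitary.conjStarAlgAut 𝕜 _ hA.eigenvectorUnitary
      (Matrix.diagonal fun i => 1 - (hA.eigenvalues i : 𝕜)) := by
  nth_rw 1 [hA.spectral_theorem]
  rw [← map_one (Unitary.conjStarAlgAut 𝕜 _ hA.eigenvectorUnitary), ← map_sub,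
    ← Matrix.diagonal_one, Matrix.diagonal_sub]
  rfl

theorem det_one_sub_eq_prod_eigenvalues :
    (1 - A).det = ∏ i, (1 - (hA.eigenvalues i : 𝕜)) := by
  rw [one_sub_eq_conjStarAlgAut hA, det_conjStarAlgAut, Matrix.det_diagonal]

open scoped MatrixOrder in
theorem eigenvalues_lt_one (hpos : (1 - A).PosDef) (i : κ) : hA.eigenvalues i < 1 := by
  have hmem : 1 - hA.eigenvalues i ∈ spectrum ℝ (1 - A) := by
    have := Set.sub_mem_sub (Set.mem_singleton (1 : ℝ)) (hA.eigenvalues_mem_spectrum_real i)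
    rwa [spectrum.singleton_sub_eq, map_one] at this
  exact sub_pos.1 (hpos.isStrictlyPositive.spectrum_pos hmem)

theorem mul_inv_one_sub_eq_conjStarAlgAut (hlt : ∀ i, hA.eigenvalues i < 1) :
    A * (1 - A)⁻¹ = Unitary.conjStarAlgAut 𝕜 _ hA.eigenvectorUnitary
      (Matrix.diagonal fun i => (hA.eigenvalues i / (1 - hA.eigenvalues i) : 𝕜)) := by
  have hinv : (1 - A)⁻¹ = Unitary.conjStarAlgAut 𝕜 _ hA.eigenvectorUnitary
      (Matrix.diagonal fun i => (1 - hA.eigenvalues i : 𝕜)⁻¹) := by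
    refine Matrix.inv_eq_right_inv ?_
    rw [one_sub_eq_conjStarAlgAut hA, ← map_mul, Matrix.diagonal_mul_diagonal]
    have hne : ∀ i, (1 - hA.eigenvalues i : 𝕜) ≠ 0 := fun i => by
      exact_mod_cast (sub_pos.2 (hlt i)).ne'
    simp only [mul_inv_cancel₀ (hne _), Matrix.diagonal_one, map_one]
  nth_rw 1 [hinv, hA.spectral_theorem]
  rw [← map_mul, Matrix.diagonal_mul_diagonal]
  simp only [div_eq_mul_inv, Function.comp_apply]

theorem trace_mul_inv_one_sub (hlt : ∀ i, hA.eigenvalues i < 1) :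
    (A * (1 - A)⁻¹).trace = ∑ i, (hA.eigenvalues i / (1 - hA.eigenvalues i) : 𝕜) := by
  rw [mul_inv_one_sub_eq_conjStarAlgAut hA hlt, trace_conjStarAlgAut, Matrix.trace_diagonal]

theorem trace_mul_inv_one_sub_mul_add_one (hlt : ∀ i, hA.eigenvalues i < 1) :
    (A * (1 - A)⁻¹ * (A * (1 - A)⁻¹ + 1)).trace =
      ∑ i, (hA.eigenvalues i / (1 - hA.eigenvalues i) ^ 2 : 𝕜) := by
  rw [mul_inv_one_sub_eq_conjStarAlgAut hA hlt,
    ← map_one (Unitary.conjStarAlgAut 𝕜 _ hA.eigenvectorUnitary), ← map_add, ← map_mul,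
    trace_conjStarAlgAut, ← Matrix.diagonal_one, Matrix.diagonal_add,
    Matrix.diagonal_mul_diagonal, Matrix.trace_diagonal]
  refine Finset.sum_congr rfl fun i _ => ?_
  have hne : (1 - hA.eigenvalues i : 𝕜) ≠ 0 := by exact_mod_cast (sub_pos.2 (hlt i)).ne'
  field_simp
  ring

end HermitianMatrices

section NhdsSet

variable {ι X : Type*} [TopologicalSpace X] {l : Filter ι} {f : ι → X} {K : Set X}

theorem exists_mapClusterPt_of_tendsto_nhdsSet [l.NeBot] (hK : IsCompact K)
    (hf : Tendsto f l (𝓝ˢ K)) : ∃ x, MapClusterPt x l f := by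
  by_contra! h
  have hdisj : Disjoint (𝓝ˢ K) (map f l) :=
    hK.disjoint_nhdsSet_left.2 fun x _ => not_not.1 (clusterPt_iff_not_disjoint.not.1 (h x))
  exact (map_neBot (m := f)).ne (hdisj.eq_bot_of_ge hf)

theorem mem_of_mapClusterPt_of_tendsto_nhdsSet [RegularSpace X] (hK : IsClosed K)
    (hf : Tendsto f l (𝓝ˢ K)) {x : X} (hx : MapClusterPt x l f) : x ∈ K := by
  by_contra hxK
  rw [← hK.closure_eq, ← disjoint_nhdsSet_nhds] at hxK
  exact clusterPt_iff_not_disjoint.1 hx (hxK.symm.mono_right hf)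

theorem tendsto_nhdsSet_Icc [LinearOrder X] [OrderTopology X] [NoMaxOrder X] {a b : X}
    (hab : a ≤ b) (ha : ∀ i, a ≤ f i) (hb : ∀ c, b < c → ∀ᶠ i in l, f i < c) :
    Tendsto f l (𝓝ˢ (Set.Icc a b)) := by
  refine (hasBasis_nhdsSet _).tendsto_right_iff.2 fun U ⟨hU, hsub⟩ => ?_
  obtain ⟨c, hbc, hcU⟩ := exists_Ico_subset_of_mem_nhds
    (hU.mem_nhds (hsub ⟨hab, le_rfl⟩)) (exists_gt b)
  filter_upwards [hb c hbc] with i hi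
  rcases le_or_gt (f i) b with h | h
  · exact hsub ⟨ha i, h⟩
  · exact hcU ⟨h.le, hi⟩

end NhdsSet

section GeometricSums

variable {κ : Type*} [Fintype κ]

/-- The mean `∑ e / (1 - e)` of a sum of independent geometric variables with ratios `e j`: the
mean of the total area when the `e j` are the eigenvalues of `ζ* ζ`. -/
def geomSumMean (e : κ → ℝ) : ℝ := ∑ j, e j / (1 - e j)

/-- The variance `∑ e / (1 - e)²` of a sum of independent geometric variables with ratios `e j`: the
variance of the total area when the `e j` are the eigenvalues of `ζ* ζ`. -/
def geomSumVar (e : κ → ℝ) : ℝ := ∑ j, e j / (1 - e j) ^ 2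

/-- The coefficient of variation of a sum of independent geometric variables with ratios `e j`. -/
def geomSumCoeffVar (e : κ → ℝ) : ℝ := √(geomSumVar e) / geomSumMean e

section Bounds

variable {e : κ → ℝ} (he : ∀ j, e j ∈ Set.Ico 0 1)
include he

theorem geomSumMean_pos (hne : e ≠ 0) : 0 < geomSumMean e := by
  obtain ⟨j, hj⟩ := Function.ne_iff.1 hne
  exact Finset.sum_pos' (fun i _ => div_nonneg (he i).1 (sub_pos.2 (he i).2).le)
    ⟨j, Finset.mem_univ j, div_pos ((he j).1.lt_of_ne' hj) (sub_pos.2 (he j).2)⟩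

theorem geomSumVar_nonneg : 0 ≤ geomSumVar e :=
  Finset.sum_nonneg fun j _ => div_nonneg (he j).1 (sq_nonneg _)

theorem geomSumMean_sq_le : geomSumMean e ^ 2 ≤ Fintype.card κ * geomSumVar e := by
  refine (sq_sum_le_card_mul_sum_sq (s := Finset.univ) (f := fun j => e j / (1 - e j))).trans ?_
  rw [Finset.card_univ]
  refine mul_le_mul_of_nonneg_left (Finset.sum_le_sum fun j _ => ?_) (Nat.cast_nonneg _)
  rw [div_pow]
  gcongr
  exact pow_le_of_le_one (he j).1 (he j).2.le two_ne_zero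

theorem mul_geomSumVar_le {δ : ℝ} (hδ : ∀ j, e j ≠ 0 → |e j - 1| < δ) :
    (1 - δ) * geomSumVar e ≤ geomSumMean e ^ 2 := by
  refine le_trans ?_ (Finset.sum_sq_le_sq_sum_of_nonneg fun j _ =>
    div_nonneg (he j).1 (sub_pos.2 (he j).2).le)
  rw [geomSumVar, Finset.mul_sum]
  refine Finset.sum_le_sum fun j _ => ?_
  rw [div_pow, ← mul_div_assoc]
  gcongr
  rcases eq_or_ne (e j) 0 with hj | hj
  · simp [hj]
  · nlinarith [(he j).1, (abs_lt.1 (hδ j hj)).1]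

theorem one_div_sqrt_card_add_one_le_geomSumCoeffVar (hne : e ≠ 0) :
    1 / √(Fintype.card κ + 1) ≤ geomSumCoeffVar e := by
  rw [geomSumCoeffVar, div_le_div_iff₀ (Real.sqrt_pos.2 (by positivity)) (geomSumMean_pos he hne),
    one_mul, ← Real.sqrt_mul (geomSumVar_nonneg he)]
  refine Real.le_sqrt_of_sq_le ((geomSumMean_sq_le he).trans ?_)
  linarith [geomSumVar_nonneg he]

theorem geomSumCoeffVar_le {δ : ℝ} (hne : e ≠ 0) (hδ1 : δ < 1)
    (hδ : ∀ j, e j ≠ 0 → |e j - 1| < δ) : geomSumCoeffVar e ≤ √(1 - δ)⁻¹ := by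
  have hmean := geomSumMean_pos he hne
  have hδ2 : 0 < 1 - δ := sub_pos.2 hδ1
  rw [geomSumCoeffVar, div_le_iff₀ hmean, Real.sqrt_le_left (by positivity), mul_pow,
    Real.sq_sqrt (inv_nonneg.2 hδ2.le), inv_mul_eq_div, le_div_iff₀ hδ2, mul_comm]
  exact mul_geomSumVar_le he hδ

theorem one_div_le_geomSumVar {δ : ℝ} (hne : e ≠ 0) (hδ2 : δ ≤ 1 / 2)
    (hδ : ∀ j, e j ≠ 0 → |e j - 1| < δ) : 1 / (2 * δ) ≤ geomSumVar e := by
  obtain ⟨j, hj⟩ := Function.ne_iff.1 hne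
  have hclose := (abs_lt.1 (hδ j hj)).1
  have hpos : 0 < 1 - e j := sub_pos.2 (he j).2
  calc 1 / (2 * δ) ≤ e j / (1 - e j) ^ 2 := by
        rw [div_le_div_iff₀ (by linarith) (by positivity)]
        nlinarith
    _ ≤ geomSumVar e := Finset.single_le_sum (f := fun j => e j / (1 - e j) ^ 2)
        (fun i _ => div_nonneg (he i).1 (sq_nonneg _)) (Finset.mem_univ j)

end Bounds

theorem geomSumCoeffVar_eq_rescaled (e : κ → ℝ) {t : ℝ} (ht : 0 < t) :
    geomSumCoeffVar e =
      √(∑ j, e j * (t / (1 - e j)) * (t / (1 - e j))) / ∑ j, e j * (t / (1 - e j)) := by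
  have hvar : ∑ j, e j * (t / (1 - e j)) * (t / (1 - e j)) = t ^ 2 * geomSumVar e := by
    rw [geomSumVar, Finset.mul_sum]
    exact Finset.sum_congr rfl fun j _ => by rw [mul_assoc, ← pow_two, div_pow]; ring
  have hmean : ∑ j, e j * (t / (1 - e j)) = t * geomSumMean e := by
    rw [geomSumMean, Finset.mul_sum]
    exact Finset.sum_congr rfl fun j _ => by ring
  rw [hvar, hmean, Real.sqrt_mul (sq_nonneg t), Real.sqrt_sq ht.le, mul_div_mul_left _ _ ht.ne',
    geomSumCoeffVar]

section Families

variable {ι : Type*} {l : Filter ι} {e : ι → κ → ℝ} (he : ∀ i j, e i j ∈ Set.Ico 0 1)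
  (hne : ∀ i, e i ≠ 0)
  (hl : ∀ ε : ℝ, 0 < ε → ∀ᶠ i in l, ∀ j, e i j ≠ 0 → |e i j - 1| < ε)
include he hne hl

theorem tendsto_geomSumVar_atTop : Tendsto (fun i => geomSumVar (e i)) l atTop := by
  refine tendsto_atTop.2 fun R => ?_
  have hR : 1 ≤ |R| + 1 := le_add_of_nonneg_left (abs_nonneg R)
  filter_upwards [hl (1 / (2 * (|R| + 1))) (by positivity)] with i hi
  have hvar := one_div_le_geomSumVar (he i) (hne i)
    (one_div_le_one_div_of_le two_pos (by linarith)) hi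
  have hδ : 1 / (2 * (1 / (2 * (|R| + 1)))) = |R| + 1 := by field_simp
  linarith [le_abs_self R]

theorem eventually_geomSumCoeffVar_lt (b : ℝ) (hb : 1 < b) :
    ∀ᶠ i in l, geomSumCoeffVar (e i) < b := by
  have hcont : ContinuousAt (fun δ : ℝ => √(1 - δ)⁻¹) 0 :=
    Real.continuous_sqrt.continuousAt.comp (ContinuousAt.inv₀ (by fun_prop) (by simp))
  have hsmall : ∀ᶠ δ in 𝓝[>] (0 : ℝ), √(1 - δ)⁻¹ < b ∧ δ < 1 :=
    nhdsWithin_le_nhds ((hcont.eventually_lt_const (by simpa using hb)).and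
      (eventually_lt_nhds one_pos))
  obtain ⟨δ, ⟨hδb, hδ1⟩, hδ0⟩ := (hsmall.and self_mem_nhdsWithin).exists
  filter_upwards [hl δ hδ0] with i hi
  exact (geomSumCoeffVar_le (he i) (hne i) hδ1 hi).trans_lt hδb

theorem tendsto_geomSumCoeffVar_nhdsSet : Tendsto (fun i => geomSumCoeffVar (e i)) l
    (𝓝ˢ (Set.Icc (1 / √(Fintype.card κ + 1)) 1)) :=
  tendsto_nhdsSet_Icc (div_le_one_of_le₀ (Real.one_le_sqrt.2 (by simp)) (Real.sqrt_nonneg _))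
    (fun i => one_div_sqrt_card_add_one_le_geomSumCoeffVar (he i) (hne i))
    (eventually_geomSumCoeffVar_lt he hne hl)

omit [Fintype κ] in
theorem tendsto_one_sub_iSup [Finite κ] : Tendsto (fun i => 1 - ⨆ k, e i k) l (𝓝 0) := by
  refine Metric.tendsto_nhds.2 fun ε hε => ?_
  filter_upwards [hl ε hε] with i hi
  obtain ⟨j, hj⟩ := Function.ne_iff.1 (hne i)
  have : Nonempty κ := ⟨j⟩
  have hle : e i j ≤ ⨆ k, e i k := le_ciSup (Set.finite_range _).bddAbove j
  have hsup : ⨆ k, e i k ≤ 1 := ciSup_le fun k => (he i k).2.le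
  rw [Real.dist_eq, sub_zero, abs_of_nonneg (sub_nonneg.2 hsup)]
  linarith [(abs_lt.1 (hi j hj)).1]

/-- In the limit, the weights `e j * (1 - max e) / (1 - e j)` of the rescaled sums become the
ratios `(1 - max e) / (1 - e j)` themselves, one of which is always `1`. -/
theorem exists_tendsto_geomSumCoeffVar [l.NeBot] {r : κ → ℝ}
    (hr : ∀ j, Tendsto (fun i => (1 - ⨆ k, e i k) / (1 - e i j)) l (𝓝 (r j))) :
    ∃ v, Tendsto (fun i => geomSumCoeffVar (e i)) l (𝓝 v) := by
  have hmax : ∀ i, ∃ j, e i j = ⨆ k, e i k := fun i =>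
    have : Nonempty κ := (Function.ne_iff.1 (hne i)).nonempty
    exists_eq_ciSup_of_finite
  have hgap : ∀ i, 0 < 1 - ⨆ k, e i k := fun i => by
    obtain ⟨j, hj⟩ := hmax i
    exact hj ▸ sub_pos.2 (he i j).2
  have hweight : ∀ j, Tendsto (fun i => e i j * ((1 - ⨆ k, e i k) / (1 - e i j))) l
      (𝓝 (r j)) := fun j => by
    refine (sub_zero (r j) ▸ (hr j).sub (tendsto_one_sub_iSup he hne hl)).congr fun i => ?_
    have hpos : 1 - e i j ≠ 0 := (sub_pos.2 (he i j).2).ne'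
    field_simp
    ring
  have hpos : 1 ≤ ∑ j, r j := by
    refine ge_of_tendsto' (tendsto_finsetSum _ fun j _ => hr j) fun i => ?_
    obtain ⟨j, hj⟩ := hmax i
    calc 1 = (1 - ⨆ k, e i k) / (1 - e i j) := by rw [hj, div_self (hgap i).ne']
      _ ≤ _ := Finset.single_le_sum (f := fun j => (1 - ⨆ k, e i k) / (1 - e i j))
        (fun k _ => div_nonneg (hgap i).le (sub_pos.2 (he i k).2).le) (Finset.mem_univ j)
  refine ⟨√(∑ j, r j * r j) / ∑ j, r j, ?_⟩
  simp only [fun i => geomSumCoeffVar_eq_rescaled (e i) (hgap i)]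
  exact (tendsto_finsetSum _ fun j _ => (hweight j).mul (hr j)).sqrt.div
    (tendsto_finsetSum _ fun j _ => hweight j) (by linarith)

end Families

end GeometricSums

section Commutators

variable {R : Type*} [Ring R]

theorem lie_mul_eq_add (x y z : R) : ⁅x, y * z⁆ = ⁅x, y⁆ * z + y * ⁅x, z⁆ := by
  simp only [Ring.lie_def]
  noncomm_ring

theorem mul_lie_eq_add (x y z : R) : ⁅x * y, z⁆ = x * ⁅y, z⁆ + ⁅x, z⁆ * y := by
  simp only [Ring.lie_def]
  noncomm_ring

end Commutators

section OrthogonalSums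

variable {ι V : Type*} [NormedAddCommGroup V] [InnerProductSpace ℂ V]

theorem hasSum_inner_right {f : ι → V} {ψ : V} (h : HasSum f ψ) (φ : V) :
    HasSum (fun i => ⟪φ, f i⟫_ℂ) ⟪φ, ψ⟫_ℂ :=
  h.mapL (innerSL ℂ φ)

theorem hasSum_norm_sq_of_orthogonal {f : ι → V} {ψ : V}
    (hf : Pairwise fun i j => ⟪f i, f j⟫_ℂ = 0) (h : HasSum f ψ) :
    HasSum (fun i => ‖f i‖ ^ 2) (‖ψ‖ ^ 2) := by
  have hcoeff : ∀ i, ⟪f i, ψ⟫_ℂ = (‖f i‖ ^ 2 : ℝ) := fun i => by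
    rw [← (hasSum_inner_right h (f i)).tsum_eq, tsum_eq_single i fun j hj => hf hj.symm,
      inner_self_eq_norm_sq_to_K]
    simp
  have hconj : HasSum (fun i => ⟪ψ, f i⟫_ℂ) ((‖ψ‖ ^ 2 : ℝ) : ℂ) := by
    simpa [inner_self_eq_norm_sq_to_K] using hasSum_inner_right h ψ
  simp only [← inner_conj_symm ψ, hcoeff, Complex.conj_ofReal] at hconj
  exact Complex.hasSum_ofReal.1 hconj

end OrthogonalSums

/-- Finitely or infinitely many oscillators on a complex inner product space: operators satisfying
the canonical commutation relations, with `create m` the adjoint of `annihilate m`. -/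
structure OscillatorSystem (M V : Type*) [DecidableEq M] [NormedAddCommGroup V]
    [InnerProductSpace ℂ V] where
  annihilate : M → Module.End ℂ V
  create : M → Module.End ℂ V
  lie_annihilate_create (m m' : M) : ⁅annihilate m, create m'⁆ = if m = m' then 1 else 0
  lie_annihilate_annihilate (m m' : M) : ⁅annihilate m, annihilate m'⁆ = 0
  inner_create_left (m : M) (φ ψ : V) : ⟪create m φ, ψ⟫_ℂ = ⟪φ, annihilate m ψ⟫_ℂ

namespace OscillatorSystem

variable {M V : Type*} [DecidableEq M] [NormedAddCommGroup V] [InnerProductSpace ℂ V]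
  (S : OscillatorSystem M V)

theorem annihilate_annihilate (m m' : M) (ψ : V) :
    S.annihilate m (S.annihilate m' ψ) = S.annihilate m' (S.annihilate m ψ) := by
  have h := LinearMap.congr_fun (S.lie_annihilate_annihilate m m') ψ
  simpa only [Ring.lie_def, LinearMap.sub_apply, Module.End.mul_apply, LinearMap.zero_apply,
    sub_eq_zero] using h

theorem annihilate_create (m m' : M) (ψ : V) : S.annihilate m (S.create m' ψ) =
    S.create m' (S.annihilate m ψ) + if m = m' then ψ else 0 := by
  have h := LinearMap.congr_fun (S.lie_annihilate_create m m') ψ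
  rw [Ring.lie_def, LinearMap.sub_apply, Module.End.mul_apply, Module.End.mul_apply,
    sub_eq_iff_eq_add'] at h
  rw [h]
  split_ifs <;> rfl

theorem inner_create_right (m : M) (φ ψ : V) :
    ⟪φ, S.create m ψ⟫_ℂ = ⟪S.annihilate m φ, ψ⟫_ℂ := by
  rw [← inner_conj_symm, inner_create_left, inner_conj_symm]

theorem commute_create (m m' : M) : Commute (S.create m) (S.create m') := by
  refine LinearMap.ext fun ψ => ext_inner_right ℂ fun φ => ?_
  simp only [Module.End.mul_apply, inner_create_left, annihilate_annihilate S m m']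

theorem lie_create_create (m m' : M) : ⁅S.create m, S.create m'⁆ = 0 := by
  rw [Ring.lie_def, (S.commute_create m m').eq, sub_self]

theorem lie_annihilate_create_eq_smul (m m' : M) :
    ⁅S.annihilate m, S.create m'⁆ = (1 : Matrix M M ℂ) m m' • (1 : Module.End ℂ V) := by
  rw [S.lie_annihilate_create, Matrix.one_apply, ite_smul, one_smul, zero_smul]

theorem inner_lie_annihilate_create (m m' : M) (ψ : V) :
    ⟪ψ, ⁅S.annihilate m, S.create m'⁆ ψ⟫_ℂ = ((‖ψ‖ ^ 2 : ℝ) : ℂ) * (1 : Matrix M M ℂ) m m' := by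
  simp [S.lie_annihilate_create_eq_smul, inner_self_eq_norm_sq_to_K, mul_comm]

variable [Fintype M]

/-- `ψ` arises from `ψ'` by adding a pair of quanta with amplitudes `W`: annihilating the mode `m`
in `ψ` leaves its partners in `ψ'`. A state paired with itself is a pair-coherent state. -/
def IsPaired (W : Matrix M M ℂ) (ψ ψ' : V) : Prop :=
  ∀ m, S.annihilate m ψ = ∑ d, W m d • S.create d ψ'

variable {S} {W : Matrix M M ℂ} {ψ ψ' : V}

theorem IsPaired.smul (h : S.IsPaired W ψ ψ') (c : ℂ) : S.IsPaired W (c • ψ) (c • ψ') := fun m => by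
  simp only [map_smul, h m, Finset.smul_sum, smul_comm c]

theorem IsPaired.contraction (hW : W.IsSymm) (h : S.IsPaired W ψ ψ') (X : Module.End ℂ V) :
    (fun b => ⟪S.annihilate b ψ, X ψ⟫_ℂ) =
      Wᴴ *ᵥ (fun d => ⟪ψ', ⁅S.annihilate d, X⁆ ψ⟫_ℂ) + (Wᴴ * W) *ᵥ
        ((fun e => ⟪ψ', ⁅X, S.create e⁆ ψ'⟫_ℂ) + fun e => ⟪S.annihilate e ψ', X ψ'⟫_ℂ) := by
  have hright : (fun d => ⟪ψ', X (S.annihilate d ψ)⟫_ℂ) = W *ᵥ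
      ((fun e => ⟪ψ', ⁅X, S.create e⁆ ψ'⟫_ℂ) + fun e => ⟪S.annihilate e ψ', X ψ'⟫_ℂ) := by
    funext d
    rw [h d]
    simp only [map_sum, map_smul, inner_sum, inner_smul_right, Matrix.mulVec, dotProduct,
      Pi.add_apply, ← S.inner_create_right, ← inner_add_right, Ring.lie_def, LinearMap.sub_apply,
      Module.End.mul_apply, sub_add_cancel]
  rw [← Matrix.mulVec_mulVec, ← hright, ← Matrix.mulVec_add]
  funext b
  rw [h b]
  simp only [sum_inner, inner_smul_left, S.inner_create_left, Matrix.mulVec, dotProduct,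
    Pi.add_apply, ← inner_add_right, Ring.lie_def, LinearMap.sub_apply, Module.End.mul_apply,
    sub_add_cancel, Matrix.conjTranspose_apply, hW.apply, RCLike.star_def]

variable (S) in
/-- The matrix `⟪a_b ψ, a_c ψ⟫` of occupations and coherences of the modes in the state `ψ`. -/
def occupations (ψ : V) : Matrix M M ℂ := Matrix.gram ℂ fun m => S.annihilate m ψ

theorem IsPaired.occupations_eq (hW : W.IsSymm) (h : S.IsPaired W ψ ψ') :
    S.occupations ψ = Wᴴ * W * (((‖ψ'‖ ^ 2 : ℝ) : ℂ) • 1 + S.occupations ψ') := by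
  ext b c
  have hc := congrFun (h.contraction hW (S.annihilate c)) b
  simp only [S.lie_annihilate_annihilate, S.inner_lie_annihilate_create, LinearMap.zero_apply,
    inner_zero_right] at hc
  rw [occupations, Matrix.gram_apply, hc, Matrix.mul_apply]
  simp [Matrix.mulVec, dotProduct, occupations, Matrix.gram_apply, Matrix.one_apply, @eq_comm M c]

/-- The matrix `N` of mean occupations `⟨a_b† a_c⟩` of the pair-coherent state with pair
amplitudes `W`. -/
def meanOccupation (W : Matrix M M ℂ) : Matrix M M ℂ := Wᴴ * W * (1 - Wᴴ * W)⁻¹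

/-- The matrix of anomalous correlations `⟨a_b a_c⟩` of the pair-coherent state with pair
amplitudes `W`. -/
def anomalous (W : Matrix M M ℂ) : Matrix M M ℂ := W * (1 - Wᴴ * W)⁻¹

theorem one_add_meanOccupation (hdet : IsUnit (1 - Wᴴ * W).det) :
    1 + meanOccupation W = (1 - Wᴴ * W)⁻¹ := by
  have h := Matrix.mul_nonsing_inv _ hdet
  rw [sub_mul, one_mul, sub_eq_iff_eq_add] at h
  exact h.symm

theorem conjTranspose_anomalous : (anomalous W)ᴴ = (1 - Wᴴ * W)⁻¹ * Wᴴ := by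
  rw [anomalous, Matrix.conjTranspose_mul, Matrix.conjTranspose_nonsing_inv,
    Matrix.conjTranspose_sub, Matrix.conjTranspose_one, Matrix.conjTranspose_mul,
    Matrix.conjTranspose_conjTranspose]

theorem meanOccupation_eq_inv_mul (hdet : IsUnit (1 - Wᴴ * W).det) :
    meanOccupation W = (1 - Wᴴ * W)⁻¹ * (Wᴴ * W) := by
  have h := Matrix.nonsing_inv_mul _ hdet
  rw [mul_sub, mul_one, sub_eq_iff_eq_add, ← one_add_meanOccupation hdet] at h
  rw [← one_add_meanOccupation hdet]
  exact add_left_cancel h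

theorem IsPaired.wick (hW : W.IsSymm) (hdet : IsUnit (1 - Wᴴ * W).det) (h : S.IsPaired W ψ ψ)
    (X : Module.End ℂ V) :
    (fun b => ⟪S.annihilate b ψ, X ψ⟫_ℂ) =
      meanOccupation W *ᵥ (fun e => ⟪ψ, ⁅X, S.create e⁆ ψ⟫_ℂ) +
        (anomalous W)ᴴ *ᵥ (fun d => ⟪ψ, ⁅S.annihilate d, X⁆ ψ⟫_ℂ) := by
  have hself := h.contraction hW X
  set G := fun b => ⟪S.annihilate b ψ, X ψ⟫_ℂ
  have hG : (1 - Wᴴ * W) *ᵥ G = Wᴴ *ᵥ (fun d => ⟪ψ, ⁅S.annihilate d, X⁆ ψ⟫_ℂ) +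
      (Wᴴ * W) *ᵥ (fun e => ⟪ψ, ⁅X, S.create e⁆ ψ⟫_ℂ) := by
    rw [Matrix.sub_mulVec, Matrix.one_mulVec]
    nth_rw 1 [hself]
    rw [Matrix.mulVec_add]
    abel
  calc G = (1 - Wᴴ * W)⁻¹ *ᵥ ((1 - Wᴴ * W) *ᵥ G) := by
        rw [Matrix.mulVec_mulVec, Matrix.nonsing_inv_mul _ hdet, Matrix.one_mulVec]
    _ = _ := by
        rw [hG, Matrix.mulVec_add, Matrix.mulVec_mulVec, Matrix.mulVec_mulVec, add_comm,
          meanOccupation_eq_inv_mul hdet, conjTranspose_anomalous]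

theorem IsPaired.inner_annihilate_annihilate (hW : W.IsSymm) (hdet : IsUnit (1 - Wᴴ * W).det)
    (h : S.IsPaired W ψ ψ) (hψ : ‖ψ‖ = 1) (b c : M) :
    ⟪S.annihilate b ψ, S.annihilate c ψ⟫_ℂ = meanOccupation W b c := by
  rw [congrFun (h.wick hW hdet (S.annihilate c)) b]
  simp only [S.lie_annihilate_annihilate, S.inner_lie_annihilate_create, LinearMap.zero_apply,
    inner_zero_right, hψ]
  simp [Matrix.mulVec, dotProduct, Matrix.one_apply]

theorem IsPaired.inner_annihilate_mul (hW : W.IsSymm) (hdet : IsUnit (1 - Wᴴ * W).det)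
    (h : S.IsPaired W ψ ψ) (hψ : ‖ψ‖ = 1) (b c : M) :
    ⟪ψ, S.annihilate b (S.annihilate c ψ)⟫_ℂ = anomalous W c b := by
  rw [h c]
  simp only [map_sum, map_smul, S.annihilate_create, inner_sum, inner_smul_right, inner_add_right,
    S.inner_create_right, h.inner_annihilate_annihilate hW hdet hψ]
  rw [anomalous, ← one_add_meanOccupation hdet, Matrix.mul_apply]
  refine Finset.sum_congr rfl fun d _ => ?_
  obtain rfl | hbd := eq_or_ne b d
  · simp [inner_self_eq_norm_sq_to_K, hψ, add_comm]
  · simp [hbd, hbd.symm]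

theorem IsPaired.inner_number_number (hW : W.IsSymm) (hdet : IsUnit (1 - Wᴴ * W).det)
    (h : S.IsPaired W ψ ψ) (hψ : ‖ψ‖ = 1) (a c : M) :
    ⟪S.create a (S.annihilate a ψ), S.create c (S.annihilate c ψ)⟫_ℂ =
      meanOccupation W a a * meanOccupation W c c +
        meanOccupation W a c * (meanOccupation W c a + (1 : Matrix M M ℂ) a c) +
        (‖anomalous W c a‖ ^ 2 : ℝ) := by
  have hraise : ∀ e, ⟪ψ, ⁅S.annihilate a * S.create c * S.annihilate c, S.create e⁆ ψ⟫_ℂ =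
      meanOccupation W c c * (1 : Matrix M M ℂ) a e +
        (meanOccupation W c a + (1 : Matrix M M ℂ) a c) * (1 : Matrix M M ℂ) c e := fun e => by
    have hnormal : S.annihilate a (S.create c ψ) =
        S.create c (S.annihilate a ψ) + (1 : Matrix M M ℂ) a c • ψ := by
      simpa [Ring.lie_def, sub_eq_iff_eq_add'] using
        LinearMap.congr_fun (S.lie_annihilate_create_eq_smul a c) ψ
    simp only [mul_lie_eq_add, S.lie_annihilate_create_eq_smul, S.lie_create_create]
    simp only [mul_smul_comm, smul_mul_assoc, mul_one, one_mul, mul_zero, LinearMap.zero_apply,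
      inner_zero_right, LinearMap.add_apply, LinearMap.smul_apply, Module.End.mul_apply, hnormal,
      smul_add, inner_add_right, inner_smul_right, S.inner_create_right,
      h.inner_annihilate_annihilate hW hdet hψ, inner_self_eq_norm_sq_to_K, hψ]
    push_cast
    ring
  have hlower : ∀ d, ⟪ψ, ⁅S.annihilate d, S.annihilate a * S.create c * S.annihilate c⁆ ψ⟫_ℂ =
      anomalous W c a * (1 : Matrix M M ℂ) d c := fun d => by
    simp [lie_mul_eq_add, S.lie_annihilate_annihilate, S.lie_annihilate_create_eq_smul,
      h.inner_annihilate_mul hW hdet hψ, mul_comm]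
  have hX := congrFun (h.wick hW hdet (S.annihilate a * S.create c * S.annihilate c)) a
  simp only [hraise, hlower] at hX
  rw [S.inner_create_left]
  refine hX.trans ?_
  simp [Matrix.mulVec, dotProduct, mul_add, Finset.sum_add_distrib, Matrix.one_apply,
    Complex.conj_mul']

theorem IsPaired.isSymm_anomalous (hW : W.IsSymm) (hdet : IsUnit (1 - Wᴴ * W).det)
    (h : S.IsPaired W ψ ψ) (hψ : ‖ψ‖ = 1) : (anomalous W).IsSymm := by
  refine Matrix.IsSymm.ext fun b c => ?_
  rw [← h.inner_annihilate_mul hW hdet hψ, annihilate_annihilate,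
    h.inner_annihilate_mul hW hdet hψ]

variable (S)

/-- The operator `½ ∑ W m m' a_m† a_m'†` creating a pair of quanta with amplitudes `W`. -/
def pairCreation (W : Matrix M M ℂ) : Module.End ℂ V :=
  (1 / 2 : ℂ) • ∑ m, ∑ m', W m m' • (S.create m * S.create m')

/-- The creation operator of the partners of a quantum in the mode `b`. -/
def partnerCreation (W : Matrix M M ℂ) (b : M) : Module.End ℂ V := ∑ d, W b d • S.create d

theorem commute_partnerCreation_pairCreation (W : Matrix M M ℂ) (b : M) :
    Commute (S.partnerCreation W b) (S.pairCreation W) :=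
  Commute.sum_left _ _ _ fun d _ => Commute.smul_left (Commute.smul_right
    (Commute.sum_right _ _ _ fun m _ => Commute.sum_right _ _ _ fun m' _ => Commute.smul_right
      ((S.commute_create d m).mul_right (S.commute_create d m')) _) _) _

theorem annihilate_pairCreation (hW : W.IsSymm) (b : M) (φ : V) :
    S.annihilate b (S.pairCreation W φ) =
      S.pairCreation W (S.annihilate b φ) + S.partnerCreation W b φ := by
  have hpair : ∀ m m', S.annihilate b (W m m' • S.create m (S.create m' φ)) =
      W m m' • S.create m (S.create m' (S.annihilate b φ)) +
        ((if b = m' then W m m' • S.create m φ else 0) +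
          if b = m then W m m' • S.create m' φ else 0) := fun m m' => by
    simp only [map_smul, S.annihilate_create, map_add, smul_add, apply_ite (S.create m), map_zero,
      smul_ite, smul_zero, add_assoc]
  simp only [pairCreation, LinearMap.smul_apply, LinearMap.sum_apply, Module.End.mul_apply,
    map_smul, map_sum, hpair, Finset.sum_add_distrib, Finset.sum_ite_irrel, Finset.sum_const_zero,
    Finset.sum_ite_eq, Finset.mem_univ, if_true, partnerCreation, hW.apply, smul_add,
    ← add_smul, add_halves, one_smul]

/-- The state with `k` pairs of quanta created from `Ω`, normalised as in the exponential series. -/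
def pairState (W : Matrix M M ℂ) (Ω : V) (k : ℕ) : V :=
  (k.factorial : ℂ)⁻¹ • (S.pairCreation W ^ k) Ω

/-- The normalised state without quanta. -/
structure IsVacuum (Ω : V) : Prop where
  norm_eq_one : ‖Ω‖ = 1
  annihilate_eq_zero (m : M) : S.annihilate m Ω = 0

variable {S} {Ω : V}

theorem pairState_zero : S.pairState W Ω 0 = Ω := by simp [pairState]

theorem pairState_succ (k : ℕ) : S.pairState W Ω (k + 1) =
    (k + 1 : ℂ)⁻¹ • S.pairCreation W (S.pairState W Ω k) := by
  simp only [pairState, map_smul, smul_smul, pow_succ', Module.End.mul_apply, Nat.factorial_succ]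
  push_cast
  rw [mul_inv]

theorem IsVacuum.isPaired_pairState (hΩ : S.IsVacuum Ω) (hW : W.IsSymm) (k : ℕ) :
    S.IsPaired W (S.pairState W Ω (k + 1)) (S.pairState W Ω k) := by
  intro b
  suffices S.annihilate b (S.pairState W Ω (k + 1)) = S.partnerCreation W b (S.pairState W Ω k) by
    simpa [partnerCreation] using this
  induction k with
  | zero =>
    rw [pairState_succ, pairState_zero, map_smul, S.annihilate_pairCreation hW,
      hΩ.annihilate_eq_zero]
    simp
  | succ k ih =>
    have hcomm : S.pairCreation W (S.partnerCreation W b (S.pairState W Ω k)) =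
        ((k : ℂ) + 1) • S.partnerCreation W b (S.pairState W Ω (k + 1)) := by
      rw [pairState_succ, map_smul, smul_inv_smul₀ k.cast_add_one_ne_zero]
      exact (LinearMap.congr_fun (S.commute_partnerCreation_pairCreation W b).eq _).symm
    rw [pairState_succ, map_smul, S.annihilate_pairCreation hW, ih, hcomm,
      inv_smul_eq_iff₀ (k + 1).cast_add_one_ne_zero]
    push_cast
    module

variable (S) in
/-- The operator `∑ a_m† a_m` counting all quanta. -/
def totalNumber : Module.End ℂ V := ∑ m, S.create m * S.annihilate m

theorem inner_totalNumber (φ χ : V) :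
    ⟪S.totalNumber φ, χ⟫_ℂ = ∑ m, ⟪S.annihilate m φ, S.annihilate m χ⟫_ℂ := by
  simp [totalNumber, S.inner_create_left]

theorem inner_totalNumber_comm (φ χ : V) : ⟪S.totalNumber φ, χ⟫_ℂ = ⟪φ, S.totalNumber χ⟫_ℂ := by
  simp [totalNumber, S.inner_create_left, S.inner_create_right]

theorem IsVacuum.totalNumber_pairState (hΩ : S.IsVacuum Ω) (hW : W.IsSymm) (k : ℕ) :
    S.totalNumber (S.pairState W Ω k) = ((2 * k : ℕ) : ℂ) • S.pairState W Ω k := by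
  cases k with
  | zero => simp [totalNumber, pairState_zero, hΩ.annihilate_eq_zero]
  | succ k =>
    rw [totalNumber, LinearMap.sum_apply]
    simp only [Module.End.mul_apply, hΩ.isPaired_pairState hW k _]
    rw [pairState_succ, pairCreation, smul_smul, LinearMap.smul_apply, smul_smul]
    have hne : (k + 1 : ℂ) ≠ 0 := k.cast_add_one_ne_zero
    have hcoeff : ((2 * (k + 1) : ℕ) : ℂ) * ((k + 1 : ℂ)⁻¹) * (1 / 2) = 1 := by
      push_cast; field_simp
    rw [hcoeff, one_smul]
    simp

theorem IsVacuum.inner_pairState_eq_zero (hΩ : S.IsVacuum Ω) (hW : W.IsSymm) {j k : ℕ}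
    (hjk : j ≠ k) : ⟪S.pairState W Ω j, S.pairState W Ω k⟫_ℂ = 0 := by
  have h := inner_totalNumber_comm (S := S) (S.pairState W Ω j) (S.pairState W Ω k)
  simp only [hΩ.totalNumber_pairState hW, inner_smul_left, inner_smul_right] at h
  rw [Complex.conj_natCast] at h
  refine (mul_eq_mul_right_iff.1 h).resolve_left fun hc => hjk ?_
  have : 2 * j = 2 * k := by exact_mod_cast hc
  lia

theorem IsVacuum.trace_occupations_pairState (hΩ : S.IsVacuum Ω) (hW : W.IsSymm) (k : ℕ) :
    (S.occupations (S.pairState W Ω k)).trace = (2 * k * ‖S.pairState W Ω k‖ ^ 2 : ℝ) := by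
  have h := inner_totalNumber (S := S) (S.pairState W Ω k) (S.pairState W Ω k)
  rw [hΩ.totalNumber_pairState hW, inner_smul_left, inner_self_eq_norm_sq_to_K,
    Complex.conj_natCast] at h
  simpa [Matrix.trace, occupations, Matrix.gram_apply] using h.symm

theorem IsVacuum.occupations_pairState (hΩ : S.IsVacuum Ω) (hW : W.IsSymm) (k : ℕ) :
    S.occupations (S.pairState W Ω (k + 1)) = ∑ p ∈ Finset.HasAntidiagonal.antidiagonal k,
      ((‖S.pairState W Ω p.1‖ ^ 2 : ℝ) : ℂ) • (Wᴴ * W) ^ (p.2 + 1) := by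
  rw [(hΩ.isPaired_pairState hW k).occupations_eq hW]
  induction k with
  | zero =>
    have hzero : S.occupations Ω = 0 := by
      ext b c
      simp [occupations, Matrix.gram_apply, hΩ.annihilate_eq_zero]
    simp [pairState_zero, hzero]
  | succ k ih =>
    rw [(hΩ.isPaired_pairState hW k).occupations_eq hW, ih, Finset.Nat.sum_antidiagonal_succ',
      mul_add, Finset.mul_sum]
    simp [pow_succ']

theorem IsVacuum.normSq_pairState_recursion (hΩ : S.IsVacuum Ω) (hW : W.IsSymm) (k : ℕ) :
    2 * (k + 1 : ℝ) * ‖S.pairState W Ω (k + 1)‖ ^ 2 = ∑ p ∈ Finset.HasAntidiagonal.antidiagonal k,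
      ‖S.pairState W Ω p.1‖ ^ 2 *
        ∑ i, (Matrix.isHermitian_conjTranspose_mul_self W).eigenvalues i ^ (p.2 + 1) := by
  have h := hΩ.trace_occupations_pairState hW (k + 1)
  rw [hΩ.occupations_pairState hW, Matrix.trace_sum] at h
  simp only [Matrix.trace_smul, smul_eq_mul,
    trace_pow_eq_sum_eigenvalues (Matrix.isHermitian_conjTranspose_mul_self W)] at h
  refine Complex.ofReal_injective ?_
  push_cast at h ⊢
  exact h.symm

theorem IsVacuum.isPaired_of_hasSum (hΩ : S.IsVacuum Ω) (hW : W.IsSymm) {ψ : V}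
    (hψ : HasSum (S.pairState W Ω) ψ) : S.IsPaired W ψ ψ := by
  refine fun m => ext_inner_left ℂ fun φ => ?_
  have hleft : HasSum (fun k => ⟪φ, S.annihilate m (S.pairState W Ω (k + 1))⟫_ℂ)
      ⟪φ, S.annihilate m ψ⟫_ℂ := by
    rw [hasSum_nat_add_iff (f := fun k => ⟪φ, S.annihilate m (S.pairState W Ω k)⟫_ℂ)]
    simpa [pairState_zero, hΩ.annihilate_eq_zero, S.inner_create_left] using
      hasSum_inner_right hψ (S.create m φ)
  refine hleft.unique ?_
  simp only [hΩ.isPaired_pairState hW _ m, inner_sum, inner_smul_right, S.inner_create_right]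
  exact hasSum_sum fun d _ => (hasSum_inner_right hψ _).mul_left _

variable (S W Ω) in
/-- The generating function of the squared norms of the pair states. -/
def normSqSeries : PowerSeries ℝ := PowerSeries.mk fun k => ‖S.pairState W Ω k‖ ^ 2

theorem IsVacuum.normSqSeries_sq (hΩ : S.IsVacuum Ω) (hW : W.IsSymm) : S.normSqSeries W Ω ^ 2 =
    geomProd Finset.univ (Matrix.isHermitian_conjTranspose_mul_self W).eigenvalues := by
  refine eq_of_derivative_eq_mul ?_ (derivative_geomProd _ _) ?_
  · have hderiv : 2 * PowerSeries.derivative ℝ (S.normSqSeries W Ω) = S.normSqSeries W Ω *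
        ∑ i, PowerSeries.mk fun k =>
          (Matrix.isHermitian_conjTranspose_mul_self W).eigenvalues i ^ (k + 1) := by
      ext k
      have h := hΩ.normSq_pairState_recursion hW k
      rw [two_mul, map_add, PowerSeries.coeff_derivative, PowerSeries.coeff_mul]
      simp only [normSqSeries, PowerSeries.coeff_mk, map_sum]
      linarith
    rw [Derivation.leibniz_pow, pow_two, mul_assoc, ← hderiv]
    simp
    ring
  · rw [map_pow, constantCoeff_geomProd, normSqSeries, PowerSeries.constantCoeff_mk]
    simp [pairState_zero, hΩ.norm_eq_one]

theorem IsVacuum.normSq_pairState_le_coeff (hΩ : S.IsVacuum Ω) (hW : W.IsSymm) (k : ℕ) :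
    ‖S.pairState W Ω k‖ ^ 2 ≤ PowerSeries.coeff k
      (geomProd Finset.univ (Matrix.isHermitian_conjTranspose_mul_self W).eigenvalues) := by
  rw [← hΩ.normSqSeries_sq hW, pow_two (S.normSqSeries W Ω), PowerSeries.coeff_mul]
  simp only [normSqSeries, PowerSeries.coeff_mk]
  calc ‖S.pairState W Ω k‖ ^ 2 = ‖S.pairState W Ω 0‖ ^ 2 * ‖S.pairState W Ω k‖ ^ 2 := by
        rw [pairState_zero, hΩ.norm_eq_one, one_pow, one_mul]
    _ ≤ ∑ p ∈ Finset.HasAntidiagonal.antidiagonal k,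
          ‖S.pairState W Ω p.1‖ ^ 2 * ‖S.pairState W Ω p.2‖ ^ 2 := by
        have hmem : (0, k) ∈ Finset.HasAntidiagonal.antidiagonal k :=
          Finset.HasAntidiagonal.mem_antidiagonal.2 (zero_add k)
        rw [← Finset.add_sum_erase _ _ hmem]
        exact le_add_of_nonneg_right (Finset.sum_nonneg fun p _ => by positivity)

theorem eigenvalues_conjTranspose_mul_self_mem_Ico (hpos : (1 - Wᴴ * W).PosDef) (i : M) :
    (Matrix.isHermitian_conjTranspose_mul_self W).eigenvalues i ∈ Set.Ico 0 1 :=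
  ⟨(Matrix.posSemidef_conjTranspose_mul_self W).eigenvalues_nonneg i, eigenvalues_lt_one _ hpos i⟩

theorem IsVacuum.summable_pow_mul_norm_pairState (hΩ : S.IsVacuum Ω) (hW : W.IsSymm)
    (hpos : (1 - Wᴴ * W).PosDef) (p : ℕ) :
    Summable fun k : ℕ => ((k : ℝ) + 1) ^ p * ‖S.pairState W Ω k‖ := by
  obtain ⟨C, r, hr, hC⟩ := exists_coeff_geomProd_le Finset.univ
    (eigenvalues_conjTranspose_mul_self_mem_Ico hpos)
  have hsqrt : √r ∈ Set.Ico 0 1 := ⟨Real.sqrt_nonneg r, by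
    simpa using Real.sqrt_lt_sqrt hr.1 hr.2⟩
  refine ((summable_add_one_pow_mul_geometric p hsqrt).mul_left √C).of_nonneg_of_le
    (fun k => by positivity) fun k => ?_
  have hnorm : ‖S.pairState W Ω k‖ ≤ √C * √r ^ k := by
    have h := Real.le_sqrt_of_sq_le ((hΩ.normSq_pairState_le_coeff hW k).trans (hC k))
    rwa [← Real.sq_sqrt hr.1, ← pow_mul, mul_comm 2 k, pow_mul,
      Real.sqrt_mul' _ (sq_nonneg (√r ^ k)), Real.sqrt_sq (pow_nonneg hsqrt.1 k)] at h
  calc ((k : ℝ) + 1) ^ p * ‖S.pairState W Ω k‖ ≤ (k + 1) ^ p * (√C * √r ^ k) := by gcongr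
    _ = √C * ((k + 1) ^ p * √r ^ k) := by ring

theorem IsVacuum.norm_pow_four_of_hasSum (hΩ : S.IsVacuum Ω) (hW : W.IsSymm)
    (hpos : (1 - Wᴴ * W).PosDef) {ψ : V} (hψ : HasSum (S.pairState W Ω) ψ) :
    ((‖ψ‖ ^ 4 : ℝ) : ℂ) = (1 - Wᴴ * W).det⁻¹ := by
  have hsum : HasSum (fun k => PowerSeries.coeff k (S.normSqSeries W Ω)) (‖ψ‖ ^ 2) := by
    simpa only [normSqSeries, PowerSeries.coeff_mk] using
      hasSum_norm_sq_of_orthogonal (fun _ _ hjk => hΩ.inner_pairState_eq_zero hW hjk) hψ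
  have hnonneg : ∀ k, 0 ≤ PowerSeries.coeff k (S.normSqSeries W Ω) := fun k => by
    simpa only [normSqSeries, PowerSeries.coeff_mk] using sq_nonneg _
  have hsq := hasSum_coeff_mul hnonneg hnonneg hsum hsum
  rw [← pow_two, hΩ.normSqSeries_sq hW] at hsq
  have hprod := hsq.unique
    (hasSum_coeff_geomProd _ (eigenvalues_conjTranspose_mul_self_mem_Ico hpos))
  rw [det_one_sub_eq_prod_eigenvalues (Matrix.isHermitian_conjTranspose_mul_self W),
    show ‖ψ‖ ^ 4 = ‖ψ‖ ^ 2 * ‖ψ‖ ^ 2 by ring, hprod]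
  push_cast
  rw [Finset.prod_inv_distrib]
  rfl

end OscillatorSystem

section RapidVectors

variable {n : ℕ}

/-- The occupation numbers `x` with one more quantum in the mode `m`. -/
def addQuantum (m : Mode n) (x : Occ n) : Occ n := Function.update x m (x m + 1)

/-- The total number of quanta in all the modes. -/
def quanta (x : Occ n) : ℕ := ∑ m, x m

theorem addQuantum_injective (m : Mode n) : Function.Injective (addQuantum m) := by
  intro x y h
  funext i
  have hi := congrFun h i
  by_cases him : i = m
  · subst him
    simpa [addQuantum] using hi
  · simpa [addQuantum, him] using hi

theorem addQuantum_update_sub_one {m : Mode n} {x : Occ n} (h : x m ≠ 0) :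
    addQuantum m (Function.update x m (x m - 1)) = x := by
  simp [addQuantum, Nat.sub_add_cancel (Nat.pos_of_ne_zero h)]

theorem eq_zero_of_notMem_range_addQuantum {m : Mode n} {x : Occ n}
    (h : x ∉ Set.range (addQuantum m)) : x m = 0 :=
  not_not.1 fun h0 => h ⟨_, addQuantum_update_sub_one h0⟩

theorem quanta_addQuantum (m : Mode n) (x : Occ n) : quanta (addQuantum m x) = quanta x + 1 := by
  rw [quanta, addQuantum, Finset.sum_update_of_mem (Finset.mem_univ m), quanta,
    ← Finset.add_sum_erase _ x (Finset.mem_univ m), Finset.sdiff_singleton_eq_erase]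
  ring

theorem apply_le_quanta (m : Mode n) (x : Occ n) : x m ≤ quanta x :=
  Finset.single_le_sum (f := x) (fun _ _ => Nat.zero_le _) (Finset.mem_univ m)

theorem lower_apply (m : Mode n) (ψ : Formal n) (x : Occ n) :
    lower m ψ x = (√((x m : ℝ) + 1) : ℂ) * ψ (addQuantum m x) := rfl

theorem raise_addQuantum (m : Mode n) (ψ : Formal n) (x : Occ n) :
    raise m ψ (addQuantum m x) = (√((x m : ℝ) + 1) : ℂ) * ψ x := by
  simp [raise, addQuantum]

theorem raise_eq_zero {m : Mode n} {x : Occ n} (h : x m = 0) (ψ : Formal n) :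
    raise m ψ x = 0 := by
  simp [raise, h]

theorem raise_lower_apply (m : Mode n) (ψ : Formal n) (x : Occ n) :
    raise m (lower m ψ) x = x m * ψ x := by
  by_cases hx : x m = 0
  · simp [raise_eq_zero hx, hx]
  · rw [← addQuantum_update_sub_one hx, raise_addQuantum, lower_apply, ← mul_assoc,
      ← Complex.ofReal_mul, Real.mul_self_sqrt (by positivity)]
    simp [addQuantum]

theorem lower_raise_apply (m : Mode n) (ψ : Formal n) (x : Occ n) :
    lower m (raise m ψ) x = (x m + 1) * ψ x := by
  rw [lower_apply, raise_addQuantum, ← mul_assoc, ← Complex.ofReal_mul,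
    Real.mul_self_sqrt (by positivity)]
  simp

theorem lie_lower_raise (m m' : Mode n) :
    ⁅(lower m : Module.End ℂ (Formal n)), raise m'⁆ = if m = m' then 1 else 0 := by
  refine LinearMap.ext fun ψ => funext fun x => ?_
  rw [Ring.lie_def, LinearMap.sub_apply, Pi.sub_apply, Module.End.mul_apply, Module.End.mul_apply]
  obtain rfl | hne := eq_or_ne m m'
  · rw [lower_raise_apply, raise_lower_apply, if_pos rfl, Module.End.one_apply]
    ring
  · simp only [lower, raise, LinearMap.coe_mk, AddHom.coe_mk, Function.update_of_ne hne,
      Function.update_of_ne hne.symm, Function.update_comm hne, if_neg hne, LinearMap.zero_apply,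
      Pi.zero_apply]
    ring

theorem lie_lower_lower (m m' : Mode n) :
    ⁅(lower m : Module.End ℂ (Formal n)), lower m'⁆ = 0 := by
  refine LinearMap.ext fun ψ => funext fun x => ?_
  obtain rfl | hne := eq_or_ne m m'
  · simp [Ring.lie_def]
  · rw [Ring.lie_def, LinearMap.sub_apply, Pi.sub_apply, Module.End.mul_apply, Module.End.mul_apply]
    simp only [lower, LinearMap.coe_mk, AddHom.coe_mk, Function.update_of_ne hne,
      Function.update_of_ne hne.symm, Function.update_comm hne, LinearMap.zero_apply, Pi.zero_apply]
    ring

theorem memℓp_comp_addQuantum_iff {m : Mode n} {f : Formal n} (hf : ∀ x, x m = 0 → f x = 0) :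
    Memℓp (fun x => f (addQuantum m x)) 2 ↔ Memℓp f 2 := by
  rw [memℓp_gen_iff (by simp), memℓp_gen_iff (by simp)]
  refine (addQuantum_injective m).summable_iff (f := fun x => ‖f x‖ ^ (2 : ENNReal).toReal)
    fun x hx => ?_
  simp [hf x (eq_zero_of_notMem_range_addQuantum hx)]

theorem memℓp_comp_addQuantum {f : Formal n} (hf : Memℓp f 2) (m : Mode n) :
    Memℓp (fun x => f (addQuantum m x)) 2 := by
  rw [memℓp_gen_iff (by simp)] at hf ⊢
  exact hf.comp_injective (addQuantum_injective m)

/-- Rapid decrease of the coefficients in the number of quanta. Rapidly decreasing vectors form a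
common invariant domain of all the operators involved. -/
def IsRapid (ψ : Formal n) : Prop := ∀ p : ℕ, Memℓp (fun x => ((quanta x : ℂ) + 1) ^ p * ψ x) 2

theorem IsRapid.memℓp {ψ : Formal n} (hψ : IsRapid ψ) : Memℓp ψ 2 := by
  simpa using hψ 0

theorem norm_sqrt_add_one_le (m : Mode n) (x : Occ n) :
    ‖(√((x m : ℝ) + 1) : ℂ)‖ ≤ quanta x + 1 := by
  have hle : (x m : ℝ) ≤ quanta x := by exact_mod_cast apply_le_quanta m x
  rw [Complex.norm_real, Real.norm_of_nonneg (Real.sqrt_nonneg _)]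
  exact Real.sqrt_le_iff.2 ⟨by positivity, by nlinarith [(quanta x).cast_nonneg (α := ℝ)]⟩

theorem norm_quanta_add_one_pow (p : ℕ) (x : Occ n) :
    ‖((quanta x : ℂ) + 1) ^ p‖ = ((quanta x : ℝ) + 1) ^ p := by
  rw [norm_pow, ← Nat.cast_add_one, Complex.norm_natCast, Nat.cast_add_one]

theorem IsRapid.lower {ψ : Formal n} (hψ : IsRapid ψ) (m : Mode n) : IsRapid (lower m ψ) := by
  intro p
  refine (memℓp_comp_addQuantum (hψ (p + 1)) m).mono' fun x => ?_
  rw [lower_apply, norm_mul, norm_mul, norm_mul, norm_quanta_add_one_pow, norm_quanta_add_one_pow,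
    quanta_addQuantum, pow_succ, ← mul_assoc]
  gcongr
  · simp
  · exact (norm_sqrt_add_one_le m x).trans (by simp)

theorem IsRapid.raise {ψ : Formal n} (hψ : IsRapid ψ) (m : Mode n) : IsRapid (raise m ψ) := by
  intro p
  rw [← memℓp_comp_addQuantum_iff (m := m) fun x hx => by rw [raise_eq_zero hx, mul_zero]]
  refine ((hψ (p + 1)).const_mul (2 ^ p)).mono' fun x => ?_
  rw [raise_addQuantum, norm_mul, norm_mul, norm_mul, norm_mul, norm_quanta_add_one_pow,
    norm_quanta_add_one_pow, quanta_addQuantum, norm_pow, Complex.norm_ofNat, pow_succ,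
    ← mul_assoc, ← mul_assoc, ← mul_assoc, ← mul_pow]
  gcongr
  · push_cast
    linarith [(quanta x).cast_nonneg (α := ℝ)]
  · exact norm_sqrt_add_one_le m x

/-- The rapidly decreasing vectors of the Hilbert space. -/
def rapid (n : ℕ) : Submodule ℂ (Fock n) where
  carrier := {ψ | IsRapid (ψ : Formal n)}
  zero_mem' p := by simpa using zero_mem_ℓp'
  add_mem' hψ hφ p := by simpa [mul_add] using! (hψ p).add (hφ p)
  smul_mem' c ψ hψ p := by simpa [mul_left_comm] using (hψ p).const_mul c

/-- The coefficients of a rapidly decreasing vector. -/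
def toFormal : rapid n →ₗ[ℂ] Formal n where
  toFun ψ := (ψ : Fock n)
  map_add' _ _ := rfl
  map_smul' _ _ := rfl

theorem toFormal_injective : Function.Injective (toFormal (n := n)) :=
  fun _ _ h => Subtype.ext (lp.ext h)

theorem isRapid_toFormal (ψ : rapid n) : IsRapid (toFormal ψ) := ψ.2

/-- The restriction to the rapidly decreasing vectors of a formal operator preserving them. -/
def restrictRapid (T : Module.End ℂ (Formal n)) (hT : ∀ ψ, IsRapid ψ → IsRapid (T ψ)) :
    Module.End ℂ (rapid n) where
  toFun ψ := ⟨⟨T (toFormal ψ), (hT _ (isRapid_toFormal ψ)).memℓp⟩, hT _ (isRapid_toFormal ψ)⟩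
  map_add' ψ φ := toFormal_injective (map_add T (toFormal ψ) (toFormal φ))
  map_smul' c ψ := toFormal_injective (map_smul T c (toFormal ψ))

theorem inner_rapid_eq_tsum (ψ φ : rapid n) :
    ⟪ψ, φ⟫_ℂ = ∑' x, ⟪toFormal ψ x, toFormal φ x⟫_ℂ :=
  lp.inner_eq_tsum (ψ : Fock n) φ

variable (n) in
/-- The `2n` oscillators, acting on the rapidly decreasing vectors. -/
def oscillators : OscillatorSystem (Mode n) (rapid n) where
  annihilate m := restrictRapid (lower m) fun _ h => h.lower m
  create m := restrictRapid (raise m) fun _ h => h.raise m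
  lie_annihilate_create m m' := LinearMap.ext fun ψ => toFormal_injective <|
    (LinearMap.congr_fun (lie_lower_raise m m') (toFormal ψ)).trans (by split_ifs <;> rfl)
  lie_annihilate_annihilate m m' := LinearMap.ext fun ψ => toFormal_injective <|
    LinearMap.congr_fun (lie_lower_lower m m') (toFormal ψ)
  inner_create_left m φ ψ := by
    rw [inner_rapid_eq_tsum, inner_rapid_eq_tsum, ← (addQuantum_injective m).tsum_eq]
    · refine tsum_congr fun x => ?_
      change ⟪raise m (toFormal φ) (addQuantum m x), _⟫_ℂ = ⟪_, lower m (toFormal ψ) x⟫_ℂ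
      rw [raise_addQuantum, lower_apply]
      simp [mul_assoc, mul_left_comm]
    · intro x hx
      by_contra hrange
      refine hx ?_
      change ⟪raise m (toFormal φ) x, _⟫_ℂ = 0
      rw [raise_eq_zero (eq_zero_of_notMem_range_addQuantum hrange), inner_zero_left]

theorem toFormal_annihilate (m : Mode n) (ψ : rapid n) :
    toFormal ((oscillators n).annihilate m ψ) = lower m (toFormal ψ) := rfl

theorem toFormal_create (m : Mode n) (ψ : rapid n) :
    toFormal ((oscillators n).create m ψ) = raise m (toFormal ψ) := rfl

theorem toFormal_totalNumber_apply (ψ : rapid n) (x : Occ n) :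
    toFormal ((oscillators n).totalNumber ψ) x = quanta x * toFormal ψ x := by
  simp only [OscillatorSystem.totalNumber, LinearMap.sum_apply, Module.End.mul_apply, map_sum,
    Finset.sum_apply, toFormal_create, toFormal_annihilate, raise_lower_apply, ← Finset.sum_mul]
  rw [quanta, Nat.cast_sum]

end RapidVectors

section PairAmplitudes

variable {n : ℕ} {ζ : Matrix (Fin n) (Fin n) ℂ}

/-- The symmetric matrix of pair amplitudes on the `2n` modes with `½ F̃_ζ = ½ ∑ W m m' a_m† a_m'†`:
it pairs the modes `A` with the modes `B`. -/
def pairAmplitudes (ζ : Matrix (Fin n) (Fin n) ℂ) : Matrix (Mode n) (Mode n) ℂ :=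
  Matrix.fromBlocks 0 (-ζ) ζ 0

theorem isSymm_pairAmplitudes (hζ : ζᵀ = -ζ) : (pairAmplitudes ζ).IsSymm :=
  Matrix.isSymm_fromBlocks_iff.2
    ⟨Matrix.isSymm_zero, by rw [Matrix.transpose_neg, hζ, neg_neg], hζ, Matrix.isSymm_zero⟩

theorem conjTranspose_mul_pairAmplitudes (ζ : Matrix (Fin n) (Fin n) ℂ) :
    (pairAmplitudes ζ)ᴴ * pairAmplitudes ζ = Matrix.fromBlocks (ζᴴ * ζ) 0 0 (ζᴴ * ζ) := by
  simp [pairAmplitudes, Matrix.fromBlocks_conjTranspose, Matrix.fromBlocks_multiply]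

theorem one_sub_conjTranspose_mul_pairAmplitudes (ζ : Matrix (Fin n) (Fin n) ℂ) :
    1 - (pairAmplitudes ζ)ᴴ * pairAmplitudes ζ =
      Matrix.fromBlocks (1 - ζᴴ * ζ) 0 0 (1 - ζᴴ * ζ) := by
  rw [conjTranspose_mul_pairAmplitudes, ← Matrix.fromBlocks_one, sub_eq_add_neg,
    Matrix.fromBlocks_neg, Matrix.fromBlocks_add, neg_zero, add_zero, ← sub_eq_add_neg]

theorem det_one_sub_pairAmplitudes (ζ : Matrix (Fin n) (Fin n) ℂ) :
    (1 - (pairAmplitudes ζ)ᴴ * pairAmplitudes ζ).det = (1 - ζᴴ * ζ).det ^ 2 := by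
  rw [one_sub_conjTranspose_mul_pairAmplitudes, Matrix.det_fromBlocks_zero₂₁, pow_two]

theorem isUnit_det_one_sub_pairAmplitudes (hdet : IsUnit (1 - ζᴴ * ζ).det) :
    IsUnit (1 - (pairAmplitudes ζ)ᴴ * pairAmplitudes ζ).det := by
  rw [det_one_sub_pairAmplitudes]
  exact hdet.pow 2

theorem posDef_one_sub_pairAmplitudes (hpos : (1 - ζᴴ * ζ).PosDef) :
    (1 - (pairAmplitudes ζ)ᴴ * pairAmplitudes ζ).PosDef := by
  have hsemi : (1 - (pairAmplitudes ζ)ᴴ * pairAmplitudes ζ).PosSemidef := by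
    let _ := hpos.isUnit.invertible
    have h := Matrix.PosDef.fromBlocks₁₁ 0 (1 - ζᴴ * ζ) hpos
    rw [Matrix.conjTranspose_zero] at h
    rw [one_sub_conjTranspose_mul_pairAmplitudes, h]
    simpa using hpos.posSemidef
  rw [hsemi.posDef_iff_det_ne_zero, det_one_sub_pairAmplitudes]
  exact pow_ne_zero 2 hpos.det_pos.ne'

theorem inv_one_sub_pairAmplitudes (hdet : IsUnit (1 - ζᴴ * ζ).det) :
    (1 - (pairAmplitudes ζ)ᴴ * pairAmplitudes ζ)⁻¹ =
      Matrix.fromBlocks (1 - ζᴴ * ζ)⁻¹ 0 0 (1 - ζᴴ * ζ)⁻¹ := by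
  rw [one_sub_conjTranspose_mul_pairAmplitudes]
  refine Matrix.inv_eq_right_inv ?_
  simp [Matrix.fromBlocks_multiply, Matrix.mul_nonsing_inv _ hdet]

theorem meanOccupation_pairAmplitudes (hdet : IsUnit (1 - ζᴴ * ζ).det) :
    OscillatorSystem.meanOccupation (pairAmplitudes ζ) = Matrix.fromBlocks
      (OscillatorSystem.meanOccupation ζ) 0 0 (OscillatorSystem.meanOccupation ζ) := by
  rw [OscillatorSystem.meanOccupation, inv_one_sub_pairAmplitudes hdet,
    conjTranspose_mul_pairAmplitudes]
  simp [Matrix.fromBlocks_multiply, OscillatorSystem.meanOccupation]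

theorem anomalous_pairAmplitudes (hdet : IsUnit (1 - ζᴴ * ζ).det) :
    OscillatorSystem.anomalous (pairAmplitudes ζ) = Matrix.fromBlocks
      0 (-OscillatorSystem.anomalous ζ) (OscillatorSystem.anomalous ζ) 0 := by
  rw [OscillatorSystem.anomalous, inv_one_sub_pairAmplitudes hdet, pairAmplitudes]
  simp [Matrix.fromBlocks_multiply, OscillatorSystem.anomalous]

end PairAmplitudes

section CoherentState

variable {n : ℕ} {ζ : Matrix (Fin n) (Fin n) ℂ}

theorem isRapid_vac : IsRapid (vac : Formal n) := by
  intro p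
  refine (memℓp_zero ((Set.finite_singleton 0).subset fun x hx => ?_)).of_exponent_ge zero_le
  by_contra hne
  exact hx (by simp [vac, Pi.single_eq_of_ne (show x ≠ 0 from hne)])

variable (n) in
/-- The vacuum as a rapidly decreasing vector. -/
def rapidVac : rapid n := ⟨⟨vac, isRapid_vac.memℓp⟩, isRapid_vac⟩

theorem isVacuum_rapidVac : (oscillators n).IsVacuum (rapidVac n) where
  norm_eq_one := by
    have h : (rapidVac n : Fock n) = lp.single 2 0 1 := lp.ext rfl
    rw [Submodule.coe_norm, h, lp.norm_single (by norm_num), norm_one]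
  annihilate_eq_zero m := toFormal_injective <| funext fun x => by
    have hne : addQuantum m x ≠ 0 := fun h => by simpa [addQuantum] using congrFun h m
    rw [toFormal_annihilate, lower_apply]
    change _ * vac (addQuantum m x) = 0
    rw [vac, Pi.single_eq_of_ne hne, mul_zero]

theorem toFormal_pairCreation (ζ : Matrix (Fin n) (Fin n) ℂ) (ψ : rapid n) :
    toFormal ((oscillators n).pairCreation (pairAmplitudes ζ) ψ) =
      ((1 / 2 : ℂ) • opFtOf ζ) (toFormal ψ) := by
  have hpair : ∑ m, ∑ m', pairAmplitudes ζ m m' •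
      ((oscillators n).create m * (oscillators n).create m') = ∑ a, ∑ b, ζ a b •
        ((oscillators n).create (Sum.inr a) * (oscillators n).create (Sum.inl b) -
          (oscillators n).create (Sum.inl a) * (oscillators n).create (Sum.inr b)) := by
    simp only [Fintype.sum_sum_type, pairAmplitudes, Matrix.fromBlocks_apply₁₁,
      Matrix.fromBlocks_apply₁₂, Matrix.fromBlocks_apply₂₁, Matrix.fromBlocks_apply₂₂,
      Matrix.zero_apply, Matrix.neg_apply, zero_smul, Finset.sum_const_zero, zero_add, add_zero,
      neg_smul, smul_sub, Finset.sum_sub_distrib, Finset.sum_neg_distrib]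
    exact neg_add_eq_sub _ _
  rw [OscillatorSystem.pairCreation, hpair]
  simp only [LinearMap.smul_apply, LinearMap.sum_apply, LinearMap.sub_apply, Module.End.mul_apply,
    map_smul, map_sum, map_sub, toFormal_create, opFtOf, opFt, opAdag, opBdag]

/-- The terms of the exponential series of the coherent state, as rapidly decreasing vectors. -/
def coherentTerm (ζ : Matrix (Fin n) (Fin n) ℂ) : ℕ → rapid n :=
  (oscillators n).pairState (pairAmplitudes ζ) (rapidVac n)

theorem coe_coherentTerm (ζ : Matrix (Fin n) (Fin n) ℂ) (k : ℕ) :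
    (coherentTerm ζ k : Fock n) = expTerm ζ k := by
  have hpow : toFormal (((oscillators n).pairCreation (pairAmplitudes ζ) ^ k) (rapidVac n)) =
      (((1 / 2 : ℂ) • opFtOf ζ) ^ k) vac := by
    induction k with
    | zero => rfl
    | succ k ih =>
      rw [pow_succ', pow_succ', Module.End.mul_apply, Module.End.mul_apply, toFormal_pairCreation,
        ih]
  exact lp.ext (congrArg (fun ψ => (k.factorial : ℂ)⁻¹ • ψ) hpow)

theorem coherentTerm_apply_eq_zero (hζ : ζᵀ = -ζ) {k : ℕ} {x : Occ n} (hx : quanta x ≠ 2 * k) :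
    toFormal (coherentTerm ζ k) x = 0 := by
  have h := congrFun (congrArg toFormal
    (isVacuum_rapidVac.totalNumber_pairState (isSymm_pairAmplitudes hζ) k)) x
  rw [toFormal_totalNumber_apply, map_smul] at h
  exact (mul_eq_mul_right_iff.1 h).resolve_left fun hc => hx (by exact_mod_cast hc)

theorem isRapid_of_hasSum {f : ℕ → Fock n} {d : ℕ → ℕ} {ψ : Fock n}
    (hd : ∀ k x, quanta x ≠ d k → f k x = 0)
    (hf : ∀ p : ℕ, Summable fun k => ((d k : ℝ) + 1) ^ p * ‖f k‖) (hψ : HasSum f ψ) :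
    IsRapid (ψ : Formal n) := by
  intro p
  have hweighted : Summable fun k => ((d k : ℂ) + 1) ^ p • f k := by
    refine Summable.of_norm ((hf p).congr fun k => ?_)
    rw [norm_smul, norm_pow, ← Nat.cast_add_one, ← Nat.cast_add_one, Complex.norm_natCast]
  obtain ⟨φ, hφ⟩ := hweighted
  suffices h : (fun x => ((quanta x : ℂ) + 1) ^ p * ψ x) = φ from h ▸ lp.memℓp φ
  funext x
  have hcoeff : ∀ k, ((d k : ℂ) + 1) ^ p * f k x = ((quanta x : ℂ) + 1) ^ p * f k x := fun k => by
    by_cases hx : quanta x = d k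
    · rw [hx]
    · rw [hd k x hx, mul_zero, mul_zero]
  have hφx : HasSum (fun k => ((d k : ℂ) + 1) ^ p * f k x) (φ x) :=
    hφ.mapL (lp.evalCLM ℂ (fun _ : Occ n => ℂ) 2 x)
  have hψx : HasSum (fun k => f k x) (ψ x) := hψ.mapL (lp.evalCLM ℂ (fun _ : Occ n => ℂ) 2 x)
  simp only [hcoeff] at hφx
  exact (hψx.mul_left _).unique hφx

theorem summable_pow_mul_norm_expTerm (hζ : ζ ∈ Omega n) (p : ℕ) :
    Summable fun k : ℕ => (((2 * k : ℕ) : ℝ) + 1) ^ p * ‖expTerm ζ k‖ := by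
  have h := (isVacuum_rapidVac (n := n)).summable_pow_mul_norm_pairState
    (isSymm_pairAmplitudes hζ.1) (posDef_one_sub_pairAmplitudes hζ.2) p
  refine (h.mul_left (2 ^ p)).of_nonneg_of_le (fun k => by positivity) fun k => ?_
  rw [← coe_coherentTerm, ← mul_assoc, ← mul_pow]
  have hle : (((2 * k : ℕ) : ℝ) + 1) ≤ 2 * (k + 1) := by push_cast; linarith
  exact mul_le_mul_of_nonneg_right (pow_le_pow_left₀ (by positivity) hle p) (norm_nonneg _)

theorem summable_expTerm (hζ : ζ ∈ Omega n) : Summable (expTerm ζ) :=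
  Summable.of_norm (by simpa using summable_pow_mul_norm_expTerm hζ 0)

theorem isRapid_tsum_expTerm (hζ : ζ ∈ Omega n) :
    IsRapid ((∑' k, expTerm ζ k : Fock n) : Formal n) :=
  isRapid_of_hasSum (d := fun k => 2 * k)
    (fun k x hx => by rw [← coe_coherentTerm]; exact coherentTerm_apply_eq_zero hζ.1 hx)
    (summable_pow_mul_norm_expTerm hζ) (summable_expTerm hζ).hasSum

theorem exists_hasSum_coherentTerm (hζ : ζ ∈ Omega n) :
    ∃ ψ : rapid n, (ψ : Fock n) = ∑' k, expTerm ζ k ∧ HasSum (coherentTerm ζ) ψ := by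
  refine ⟨⟨_, isRapid_tsum_expTerm hζ⟩, rfl, ?_⟩
  rw [← Topology.IsInducing.hasSum_iff (g := (rapid n).subtype) Topology.IsInducing.subtypeVal]
  exact (summable_expTerm hζ).hasSum.congr_fun fun k => coe_coherentTerm ζ k

theorem exists_isPaired_eq_coherent (hζ : ζ ∈ Omega n) : ∃ ψ : rapid n, (ψ : Fock n) = coherent ζ ∧
    ‖ψ‖ = 1 ∧ (oscillators n).IsPaired (pairAmplitudes ζ) ψ ψ := by
  obtain ⟨ψ, hcoe, hψ⟩ := exists_hasSum_coherentTerm hζ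
  have hpaired := isVacuum_rapidVac.isPaired_of_hasSum (isSymm_pairAmplitudes hζ.1) hψ
  refine ⟨(√(1 - ζᴴ * ζ).det.re : ℂ) • ψ, by rw [coherent, ← hcoe]; rfl, ?_, hpaired.smul _⟩
  have hnorm := isVacuum_rapidVac.norm_pow_four_of_hasSum (isSymm_pairAmplitudes hζ.1)
    (posDef_one_sub_pairAmplitudes hζ.2) hψ
  obtain ⟨hre, him⟩ := Complex.pos_iff.1 hζ.2.det_pos
  have hdet : (1 - ζᴴ * ζ).det = ((1 - ζᴴ * ζ).det.re : ℂ) :=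
    Complex.ext rfl (by simpa using him.symm)
  set d := (1 - ζᴴ * ζ).det.re
  rw [det_one_sub_pairAmplitudes, hdet] at hnorm
  have hsq : (√d * ‖ψ‖) ^ 4 = 1 ^ 4 := by
    have hreal : ‖ψ‖ ^ 4 = (d ^ 2)⁻¹ := by exact_mod_cast hnorm
    rw [mul_pow, hreal, show √d ^ 4 = (√d ^ 2) ^ 2 by ring, Real.sq_sqrt hre.le, one_pow]
    exact mul_inv_cancel₀ (by positivity)
  rw [norm_smul, Complex.norm_real, Real.norm_of_nonneg (Real.sqrt_nonneg _)]
  exact (pow_left_inj₀ (by positivity) zero_le_one (by norm_num)).1 hsq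

end CoherentState

section Areas

variable {n : ℕ}

/-- The operator `𝒜_ab` on the rapidly decreasing vectors. -/
def rapidAreaAB (a b : Fin n) : Module.End ℂ (rapid n) :=
  (1 / 2 : ℂ) • ((oscillators n).create (Sum.inl a) * (oscillators n).annihilate (Sum.inl b) +
    (oscillators n).create (Sum.inr a) * (oscillators n).annihilate (Sum.inr b))

variable (n) in
/-- The total area on the rapidly decreasing vectors. -/
def rapidTotalArea : Module.End ℂ (rapid n) := ∑ a, rapidAreaAB a a

theorem areaAB_toFormal (a b : Fin n) (ψ : rapid n) :
    areaAB a b (toFormal ψ) = toFormal (rapidAreaAB a b ψ) := by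
  simp only [areaAB, opE, add_sub_cancel_right, rapidAreaAB, LinearMap.smul_apply,
    LinearMap.add_apply, Module.End.mul_apply, map_smul, map_add, toFormal_create,
    toFormal_annihilate, opA, opAdag, opB, opBdag]

theorem totalArea_toFormal (ψ : rapid n) :
    totalArea (toFormal ψ) = toFormal (rapidTotalArea n ψ) := by
  simp only [totalArea, area, rapidTotalArea, LinearMap.sum_apply, map_sum, areaAB_toFormal]

theorem area_mul_area_toFormal (a b : Fin n) (ψ : rapid n) : (area a * area b) (toFormal ψ) =
    toFormal (rapidAreaAB a a (rapidAreaAB b b ψ)) := by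
  rw [Module.End.mul_apply, area, area, areaAB_toFormal, areaAB_toFormal]

theorem totalArea_mul_totalArea_toFormal (ψ : rapid n) :
    (totalArea * totalArea : Module.End ℂ (Formal n)) (toFormal ψ) =
      toFormal (rapidTotalArea n (rapidTotalArea n ψ)) := by
  rw [Module.End.mul_apply, totalArea_toFormal, totalArea_toFormal]

theorem inner_rapidAreaAB_left (a b : Fin n) (φ ψ : rapid n) :
    ⟪rapidAreaAB a b φ, ψ⟫_ℂ = ⟪φ, rapidAreaAB b a ψ⟫_ℂ := by
  simp only [rapidAreaAB, LinearMap.smul_apply, LinearMap.add_apply, Module.End.mul_apply,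
    inner_smul_left, inner_smul_right, inner_add_left, inner_add_right,
    OscillatorSystem.inner_create_left, OscillatorSystem.inner_create_right, map_div₀, map_one,
    map_ofNat]

theorem inner_rapidTotalArea_left (φ ψ : rapid n) :
    ⟪rapidTotalArea n φ, ψ⟫_ℂ = ⟪φ, rapidTotalArea n ψ⟫_ℂ := by
  simp only [rapidTotalArea, LinearMap.sum_apply, sum_inner, inner_sum, inner_rapidAreaAB_left]

theorem mem_domain_hilbertOp {T : Module.End ℂ (Formal n)} {ψ φ : rapid n}
    (h : T (toFormal ψ) = toFormal φ) : (ψ : Fock n) ∈ (hilbertOp T).domain := by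
  change Memℓp (T (toFormal ψ)) 2
  exact h ▸ (isRapid_toFormal φ).memℓp

theorem expect_eq_inner {T : Module.End ℂ (Formal n)} {ψ φ : rapid n}
    (h : T (toFormal ψ) = toFormal φ) : expect T ψ = ⟪ψ, φ⟫_ℂ := by
  rw [expect, dif_pos (mem_domain_hilbertOp h), Submodule.coe_inner]
  exact congrArg (fun χ => ⟪(ψ : Fock n), χ⟫_ℂ) (lp.ext h)

section PairedStates

variable {ζ : Matrix (Fin n) (Fin n) ℂ} {ψ : rapid n}

theorem inner_rapidAreaAB (hζ : ζᵀ = -ζ) (hdet : IsUnit (1 - ζᴴ * ζ).det)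
    (h : (oscillators n).IsPaired (pairAmplitudes ζ) ψ ψ) (hψ : ‖ψ‖ = 1) (a b : Fin n) :
    ⟪ψ, rapidAreaAB a b ψ⟫_ℂ = OscillatorSystem.meanOccupation ζ a b := by
  have hdet' := isUnit_det_one_sub_pairAmplitudes hdet
  simp only [rapidAreaAB, LinearMap.smul_apply, LinearMap.add_apply, Module.End.mul_apply,
    inner_smul_right, inner_add_right, OscillatorSystem.inner_create_right,
    h.inner_annihilate_annihilate (isSymm_pairAmplitudes hζ) hdet' hψ,
    meanOccupation_pairAmplitudes hdet, Matrix.fromBlocks_apply₁₁, Matrix.fromBlocks_apply₂₂]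
  ring

/-- Anomalous correlations couple an oscillator `A` to an oscillator `B` only, and those of a single
leg vanish by antisymmetry. -/
theorem inner_rapidAreaAB_rapidAreaAB_self (hζ : ζᵀ = -ζ) (hdet : IsUnit (1 - ζᴴ * ζ).det)
    (h : (oscillators n).IsPaired (pairAmplitudes ζ) ψ ψ) (hψ : ‖ψ‖ = 1) (a : Fin n) :
    ⟪rapidAreaAB a a ψ, rapidAreaAB a a ψ⟫_ℂ = OscillatorSystem.meanOccupation ζ a a ^ 2 +
      1 / 2 * (OscillatorSystem.meanOccupation ζ a a *
        (OscillatorSystem.meanOccupation ζ a a + 1)) := by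
  have hdet' := isUnit_det_one_sub_pairAmplitudes hdet
  have hanomalous : OscillatorSystem.anomalous ζ a a = 0 := by
    have hsymm := (h.isSymm_anomalous (isSymm_pairAmplitudes hζ) hdet' hψ).apply
      (Sum.inl a) (Sum.inr a)
    rw [anomalous_pairAmplitudes hdet] at hsymm
    exact self_eq_neg.1 hsymm
  simp only [rapidAreaAB, LinearMap.smul_apply, LinearMap.add_apply, Module.End.mul_apply,
    inner_smul_left, inner_smul_right, inner_add_left, inner_add_right,
    h.inner_number_number (isSymm_pairAmplitudes hζ) hdet' hψ,
    meanOccupation_pairAmplitudes hdet, anomalous_pairAmplitudes hdet, Matrix.fromBlocks_apply₁₁,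
    Matrix.fromBlocks_apply₁₂, Matrix.fromBlocks_apply₂₁, Matrix.fromBlocks_apply₂₂,
    Matrix.neg_apply, hanomalous, Matrix.one_apply, map_div₀, map_one, map_ofNat]
  simp
  ring

theorem sum_number_inr_eq_sum_number_inl (hζ : ζᵀ = -ζ)
    (h : (oscillators n).IsPaired (pairAmplitudes ζ) ψ ψ) :
    ∑ a, (oscillators n).create (Sum.inr a) ((oscillators n).annihilate (Sum.inr a) ψ) =
      ∑ a, (oscillators n).create (Sum.inl a) ((oscillators n).annihilate (Sum.inl a) ψ) := by
  have hinl : ∀ a, (oscillators n).annihilate (Sum.inl a) ψ =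
      ∑ b, -ζ a b • (oscillators n).create (Sum.inr b) ψ := fun a => by
    simp [h (Sum.inl a), pairAmplitudes]
  have hinr : ∀ a, (oscillators n).annihilate (Sum.inr a) ψ =
      ∑ b, ζ a b • (oscillators n).create (Sum.inl b) ψ := fun a => by
    simp [h (Sum.inr a), pairAmplitudes]
  simp only [hinl, hinr, map_sum, map_smul]
  rw [Finset.sum_comm]
  refine Finset.sum_congr rfl fun a _ => Finset.sum_congr rfl fun b _ => ?_
  rw [← Module.End.mul_apply, ((oscillators n).commute_create _ _).eq, Module.End.mul_apply,
    ← Matrix.neg_apply, ← hζ, Matrix.transpose_apply]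

theorem rapidTotalArea_eq_sum_number_inl (hζ : ζᵀ = -ζ)
    (h : (oscillators n).IsPaired (pairAmplitudes ζ) ψ ψ) : rapidTotalArea n ψ =
      ∑ a, (oscillators n).create (Sum.inl a) ((oscillators n).annihilate (Sum.inl a) ψ) := by
  simp only [rapidTotalArea, rapidAreaAB, LinearMap.sum_apply, LinearMap.smul_apply,
    LinearMap.add_apply, Module.End.mul_apply, ← Finset.smul_sum, Finset.sum_add_distrib,
    sum_number_inr_eq_sum_number_inl hζ h]
  module

theorem inner_rapidTotalArea_rapidTotalArea (hζ : ζᵀ = -ζ) (hdet : IsUnit (1 - ζᴴ * ζ).det)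
    (h : (oscillators n).IsPaired (pairAmplitudes ζ) ψ ψ) (hψ : ‖ψ‖ = 1) :
    ⟪rapidTotalArea n ψ, rapidTotalArea n ψ⟫_ℂ =
      (OscillatorSystem.meanOccupation ζ).trace ^ 2 +
        ∑ a, ∑ b, OscillatorSystem.meanOccupation ζ a b *
          (OscillatorSystem.meanOccupation ζ b a + if a = b then 1 else 0) := by
  have hdet' := isUnit_det_one_sub_pairAmplitudes hdet
  simp only [rapidTotalArea_eq_sum_number_inl hζ h, sum_inner, inner_sum,
    h.inner_number_number (isSymm_pairAmplitudes hζ) hdet' hψ, meanOccupation_pairAmplitudes hdet,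
    anomalous_pairAmplitudes hdet, Matrix.fromBlocks_apply₁₁, Matrix.zero_apply, Matrix.one_apply,
    Sum.inl.injEq]
  rw [Finset.sum_comm]
  simp [Finset.sum_add_distrib, Matrix.trace, pow_two, Finset.sum_mul_sum]

end PairedStates

end Areas

section AreaMoments

variable {n : ℕ} {ζ : Matrix (Fin n) (Fin n) ℂ}

theorem coherent_mem_domain_areaAB (hζ : ζ ∈ Omega n) (a b : Fin n) :
    coherent ζ ∈ (hilbertOp (areaAB a b)).domain := by
  obtain ⟨ψ, hcoe, -⟩ := exists_isPaired_eq_coherent hζ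
  exact hcoe ▸ mem_domain_hilbertOp (areaAB_toFormal a b ψ)

theorem coherent_mem_domain_area_mul_area (hζ : ζ ∈ Omega n) (a b : Fin n) :
    coherent ζ ∈ (hilbertOp (area a * area b)).domain := by
  obtain ⟨ψ, hcoe, -⟩ := exists_isPaired_eq_coherent hζ
  exact hcoe ▸ mem_domain_hilbertOp (area_mul_area_toFormal a b ψ)

theorem coherent_mem_domain_totalArea (hζ : ζ ∈ Omega n) :
    coherent ζ ∈ (hilbertOp (totalArea (n := n))).domain := by
  obtain ⟨ψ, hcoe, -⟩ := exists_isPaired_eq_coherent hζ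
  exact hcoe ▸ mem_domain_hilbertOp (totalArea_toFormal ψ)

theorem coherent_mem_domain_totalArea_mul_totalArea (hζ : ζ ∈ Omega n) :
    coherent ζ ∈ (hilbertOp (totalArea (n := n) * totalArea)).domain := by
  obtain ⟨ψ, hcoe, -⟩ := exists_isPaired_eq_coherent hζ
  exact hcoe ▸ mem_domain_hilbertOp (totalArea_mul_totalArea_toFormal ψ)

theorem norm_coherent (hζ : ζ ∈ Omega n) : ‖coherent ζ‖ = 1 := by
  obtain ⟨ψ, hcoe, hψ, -⟩ := exists_isPaired_eq_coherent hζ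
  exact hcoe ▸ hψ

theorem expect_areaAB (hζ : ζ ∈ Omega n) (a b : Fin n) :
    expect (areaAB a b) (coherent ζ) = (ζᴴ * ζ * (1 - ζᴴ * ζ)⁻¹) a b := by
  obtain ⟨ψ, hcoe, hψ, h⟩ := exists_isPaired_eq_coherent hζ
  rw [← hcoe, expect_eq_inner (areaAB_toFormal a b ψ)]
  exact inner_rapidAreaAB hζ.1 hζ.2.det_pos.ne'.isUnit h hψ a b

theorem expect_totalArea (hζ : ζ ∈ Omega n) :
    expect totalArea (coherent ζ) = (ζᴴ * ζ * (1 - ζᴴ * ζ)⁻¹).trace := by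
  obtain ⟨ψ, hcoe, hψ, h⟩ := exists_isPaired_eq_coherent hζ
  rw [← hcoe, expect_eq_inner (totalArea_toFormal ψ), rapidTotalArea, LinearMap.sum_apply,
    inner_sum]
  exact Finset.sum_congr rfl fun a _ =>
    inner_rapidAreaAB hζ.1 hζ.2.det_pos.ne'.isUnit h hψ a a

theorem var_area (hζ : ζ ∈ Omega n) (a : Fin n) : var (area a) (coherent ζ) =
    1 / 2 * expect (area a) (coherent ζ) * (expect (area a) (coherent ζ) + 1) := by
  obtain ⟨ψ, hcoe, hψ, h⟩ := exists_isPaired_eq_coherent hζ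
  rw [var, cov, area, expect_areaAB hζ, ← hcoe, ← area,
    expect_eq_inner (area_mul_area_toFormal a a ψ), ← inner_rapidAreaAB_left,
    inner_rapidAreaAB_rapidAreaAB_self hζ.1 hζ.2.det_pos.ne'.isUnit h hψ,
    OscillatorSystem.meanOccupation]
  ring

theorem var_totalArea (hζ : ζ ∈ Omega n) : var totalArea (coherent ζ) =
    ∑ a : Fin n, ∑ b : Fin n, expect (areaAB a b) (coherent ζ) *
      (expect (areaAB b a) (coherent ζ) + if a = b then 1 else 0) := by
  simp only [var, cov, expect_totalArea hζ, expect_areaAB hζ]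
  obtain ⟨ψ, hcoe, hψ, h⟩ := exists_isPaired_eq_coherent hζ
  rw [← hcoe, expect_eq_inner (totalArea_mul_totalArea_toFormal ψ), ← inner_rapidTotalArea_left,
    inner_rapidTotalArea_rapidTotalArea hζ.1 hζ.2.det_pos.ne'.isUnit h hψ, pow_two]
  exact add_sub_cancel_left _ _

theorem eig_mem_Ico (hζ : ζ ∈ Omega n) (j : Fin n) : eig ζ j ∈ Set.Ico 0 1 :=
  OscillatorSystem.eigenvalues_conjTranspose_mul_self_mem_Ico hζ.2 j

theorem eig_ne_zero (h : ζ ≠ 0) : eig ζ ≠ 0 := fun h0 =>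
  h (Matrix.conjTranspose_mul_self_eq_zero.1
    ((Matrix.isHermitian_conjTranspose_mul_self ζ).eigenvalues_eq_zero_iff.1 h0))

theorem expect_totalArea_eq_geomSumMean (hζ : ζ ∈ Omega n) :
    expect totalArea (coherent ζ) = geomSumMean (eig ζ) := by
  rw [expect_totalArea hζ, trace_mul_inv_one_sub _ fun j => (eig_mem_Ico hζ j).2, geomSumMean]
  push_cast
  rfl

theorem var_totalArea_eq_geomSumVar (hζ : ζ ∈ Omega n) :
    var totalArea (coherent ζ) = geomSumVar (eig ζ) := by
  have htrace := trace_mul_inv_one_sub_mul_add_one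
    (Matrix.isHermitian_conjTranspose_mul_self ζ) fun j => (eig_mem_Ico hζ j).2
  refine Eq.trans ?_ (htrace.trans ?_)
  · simp only [var_totalArea hζ, expect_areaAB hζ, Matrix.trace, Matrix.diag_apply,
      Matrix.mul_apply (M := _ * (1 - ζᴴ * ζ)⁻¹), Matrix.add_apply, Matrix.one_apply,
      eq_comm]
  · rw [geomSumVar]
    push_cast
    rfl

theorem coeffVar_totalArea (hζ : ζ ∈ Omega n) :
    coeffVar totalArea (coherent ζ) = geomSumCoeffVar (eig ζ) := by
  rw [coeffVar, var_totalArea_eq_geomSumVar hζ, expect_totalArea_eq_geomSumMean hζ,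
    Complex.ofReal_re, Complex.ofReal_re, geomSumCoeffVar]

end AreaMoments

end CoherentIntertwiner

end

open CoherentIntertwiner in
theorem mainTheorem11 (n : ℕ) :
    (∀ ζ ∈ Omega n,
      -- the state is well defined and normalised, and lies in the domains of all the operators
      (Summable (expTerm ζ) ∧ ‖coherent ζ‖ = 1) ∧
      (∀ a b : Fin n, coherent ζ ∈ (hilbertOp (areaAB a b)).domain) ∧
      (∀ a b : Fin n, coherent ζ ∈ (hilbertOp (area a * area b)).domain) ∧
      coherent ζ ∈ (hilbertOp (totalArea (n := n))).domain ∧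
      coherent ζ ∈ (hilbertOp (totalArea (n := n) * totalArea)).domain ∧
      -- expectation values
      (∀ a : Fin n, expect (area a) (coherent ζ) = (ζᴴ * ζ * (1 - ζᴴ * ζ)⁻¹) a a) ∧
      expect totalArea (coherent ζ) = (ζᴴ * ζ * (1 - ζᴴ * ζ)⁻¹).trace ∧
      -- variances
      (∀ a : Fin n, var (area a) (coherent ζ) =
        1 / 2 * expect (area a) (coherent ζ) * (expect (area a) (coherent ζ) + 1)) ∧
      var totalArea (coherent ζ) =
        ∑ a : Fin n, ∑ b : Fin n, expect (areaAB a b) (coherent ζ) *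
          (expect (areaAB b a) (coherent ζ) + if a = b then 1 else 0)) ∧
    -- the limit in which the non-zero eigenvalues approach one
    (∃ c : ℝ, 0 < c ∧ c ≤ 1 ∧
      ∀ (ι : Type*) (l : Filter ι) [l.NeBot] (Z : ι → Matrix (Fin n) (Fin n) ℂ),
        (∀ i, Z i ∈ Omega n) → (∀ i, Z i ≠ 0) → NonzeroEigTendToOne l Z →
        -- the variance grows without bound
        Tendsto (fun i => (var totalArea (coherent (Z i))).re) l atTop ∧
        -- the coefficient of variation approaches `[c, 1]`; it has limit points, all in `(0, 1]`
        Tendsto (fun i => coeffVar totalArea (coherent (Z i))) l (𝓝ˢ (Set.Icc c 1)) ∧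
        (∃ v : ℝ, MapClusterPt v l (fun i => coeffVar totalArea (coherent (Z i)))) ∧
        (∀ v : ℝ, MapClusterPt v l (fun i => coeffVar totalArea (coherent (Z i))) →
          v ∈ Set.Ioc (0 : ℝ) 1) ∧
        -- it converges whenever the relative rates of approach do
        (∀ r : Fin n → ℝ,
          (∀ j, Tendsto (fun i => (1 - ⨆ k, eig (Z i) k) / (1 - eig (Z i) j)) l (𝓝 (r j))) →
          ∃ v ∈ Set.Ioc (0 : ℝ) 1,
            Tendsto (fun i => coeffVar totalArea (coherent (Z i))) l (𝓝 v))) := by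
  constructor
  · exact fun ζ hζ => ⟨⟨summable_expTerm hζ, norm_coherent hζ⟩, coherent_mem_domain_areaAB hζ,
      coherent_mem_domain_area_mul_area hζ, coherent_mem_domain_totalArea hζ,
      coherent_mem_domain_totalArea_mul_totalArea hζ, fun a => expect_areaAB hζ a a,
      expect_totalArea hζ, var_area hζ, var_totalArea hζ⟩
  have hc0 : 0 < 1 / √(Fintype.card (Fin n) + 1 : ℝ) := by positivity
  have hc1 : 1 / √(Fintype.card (Fin n) + 1 : ℝ) ≤ 1 :=
    div_le_one_of_le₀ (Real.one_le_sqrt.2 (by simp)) (Real.sqrt_nonneg _)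
  refine ⟨_, hc0, hc1, fun ι l _ Z hZ hne hl => ?_⟩
  have he := fun i => eig_mem_Ico (hZ i)
  have hne' := fun i => eig_ne_zero (hne i)
  simp only [fun i => var_totalArea_eq_geomSumVar (hZ i), fun i => coeffVar_totalArea (hZ i),
    Complex.ofReal_re]
  have hcv := tendsto_geomSumCoeffVar_nhdsSet he hne' hl
  have hlimit : ∀ v, MapClusterPt v l (fun i => geomSumCoeffVar (eig (Z i))) →
      v ∈ Set.Ioc (0 : ℝ) 1 := fun v hv =>
    have hmem := mem_of_mapClusterPt_of_tendsto_nhdsSet isClosed_Icc hcv hv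
    ⟨hc0.trans_le hmem.1, hmem.2⟩
  refine ⟨tendsto_geomSumVar_atTop he hne' hl, hcv,
    exists_mapClusterPt_of_tendsto_nhdsSet isCompact_Icc hcv, hlimit, fun r hr => ?_⟩
  obtain ⟨v, hv⟩ := exists_tendsto_geomSumCoeffVar he hne' hl hr
  exact ⟨v, hlimit v hv.mapClusterPt, hv⟩
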